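/- **Setting.** Let $B=\{u\in\mathbb{R}^d:\|u\|_2\le 1\}$ and, for $\kappa\ge 1$, let $F:B\to\mathbb{R}^n$ be differentiable on $B$ (one-sidedly at the boundary) with $$\kappa^{-1}\|u-w\|_2\le\|F(u)-F(w)\|_2\le\kappa\|u-w\|_2,\qquad \|DF(u)-DF(w)\|_{\ell_2^d\to\ell_2^n}\le\kappa\|u-w\|_2\qquad(u,w\in B),$$ and put $\mathcal{M}=F(B)$. The unit tangent vectors of $\mathcal{M}$ are the unit vectors in the subspaces $DF(u)(\mathbb{R}^d)$, $u\in B$. For a subset $S$ of a Euclidean space let $\rho_S(p,q)$ be the infimum of the lengths of the $C^1$ curves in $S$ joining $p$ to $q$. Let $\Phi\in\mathbb{R}^{m\times n}$ be the sparse Johnson–Lindenstrauss transform with column sparsity $s$: $\Phi_{ij}=s^{-1/2}\sigma_{ij}\delta_{ij}$, where the $\sigma_{ij}$ are independent uniform signs, independent of the random variables $\delta_{ij}\in\{0,1\}$; the columns $(\delta_{ij})_{i\le m}$ are independent for different $j$; $\sum_{i=1}^m\delta_{ij}=s$ for each $j$; and $\mathbb{E}\,\delta_{ij}=s/m$, $\mathbb{E}\prod_{i\in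 I}\delta_{ij}\le (s/m)^{|I|}$ for all $j$ and all $I\subseteq\{1,\dots,m\}$. **Theorem.** There is a universal constant $c>0$ and, for every $\kappa\ge1$, a constant $C=C(\kappa)>0$ such that, whenever $\mathcal{M}$ is as above and $$m\ge C\,d(\log n)^2,\qquad s\ge C(\log n)^2,$$ there is an event of probability at least $1-e^{-cs}$ on which the following holds for every $\varepsilon\in(0,1)$: if $$1-\varepsilon\le\|\Phi v\|_2\le 1+\varepsilon\qquad\text{for all unit tangent vectors } v \text{ of }\mathcal{M},$$ then $\Phi$ preserves geodesic distances on $\mathcal{M}$ up to a factor $1\pm\varepsilon$, that is, $$(1-\varepsilon)\,\rho_{\mathcal{M}}(x,y)\le\rho_{\Phi(\mathcal{M})}(\Phi x,\Phi y)\le(1+\varepsilon)\,\rho_{\mathcal{M}}(x,y)\qquad\text{for all }x,y\in\mathcal{M}.$$ -/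

import Mathlib

open Set MeasureTheory ProbabilityTheory
open scoped ENNReal

noncomputable section

/-- The length `∫₀¹ ‖γ'(t)‖ dt` of a curve parametrized by `[0, 1]` (only used for `C¹` curves; at
the end points the derivative is one-sided). -/
def curveLength {E : Type*} [NormedAddCommGroup E] [NormedSpace ℝ E] (γ : ℝ → E) : ℝ≥0∞ :=
  ∫⁻ t in Icc (0 : ℝ) 1, ‖derivWithin γ (Icc (0 : ℝ) 1) t‖ₑ

/-- `γ : [0, 1] → E` is a `C¹` curve with image in `S`, going from `x` to `y`. -/
structure IsC1CurveIn {E : Type*} [NormedAddCommGroup E] [NormedSpace ℝ E]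
    (S : Set E) (x y : E) (γ : ℝ → E) : Prop where
  contDiffOn : ContDiffOn ℝ 1 γ (Icc (0 : ℝ) 1)
  mapsTo : MapsTo γ (Icc (0 : ℝ) 1) S
  source : γ 0 = x
  target : γ 1 = y

/-- Geodesic distance in a subset `S` of a normed space: the infimum of the lengths of the `C¹`
curves in `S` from `x` to `y` (`∞` if there is no such curve). -/
def geodesicDist {E : Type*} [NormedAddCommGroup E] [NormedSpace ℝ E]
    (S : Set E) (x y : E) : ℝ≥0∞ :=
  ⨅ (γ : ℝ → E) (_ : IsC1CurveIn S x y γ), curveLength γ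

/-- The closed unit ball of `ℓ₂ᵈ`. -/
def unitBall (d : ℕ) : Set (EuclideanSpace ℝ (Fin d)) :=
  Metric.closedBall 0 1

/-- The derivative of `F` on the closed unit ball (one-sided at the boundary). -/
def ballDeriv {d n : ℕ} (F : EuclideanSpace ℝ (Fin d) → EuclideanSpace ℝ (Fin n))
    (u : EuclideanSpace ℝ (Fin d)) :
    EuclideanSpace ℝ (Fin d) →L[ℝ] EuclideanSpace ℝ (Fin n) :=
  fderivWithin ℝ F (unitBall d) u

/-- `F` is differentiable on the closed unit ball, bi-Lipschitz there with constant `κ`, and its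
derivative is `κ`-Lipschitz in operator norm. Only the values of `F` on the ball matter. -/
structure IsBiLipschitzParam {d n : ℕ} (κ : ℝ)
    (F : EuclideanSpace ℝ (Fin d) → EuclideanSpace ℝ (Fin n)) : Prop where
  le_dist : ∀ u ∈ unitBall d, ∀ w ∈ unitBall d, κ⁻¹ * ‖u - w‖ ≤ ‖F u - F w‖
  dist_le : ∀ u ∈ unitBall d, ∀ w ∈ unitBall d, ‖F u - F w‖ ≤ κ * ‖u - w‖
  differentiableOn : DifferentiableOn ℝ F (unitBall d)
  deriv_lipschitz : ∀ u ∈ unitBall d, ∀ w ∈ unitBall d,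
    ‖ballDeriv F u - ballDeriv F w‖ ≤ κ * ‖u - w‖

/-- The unit tangent vectors of `F (unitBall d)`: the unit vectors in the ranges of the
derivatives of `F` at the points of the ball. -/
def unitTangentVectors {d n : ℕ} (F : EuclideanSpace ℝ (Fin d) → EuclideanSpace ℝ (Fin n)) :
    Set (EuclideanSpace ℝ (Fin n)) :=
  {v | ‖v‖ = 1 ∧ ∃ u ∈ unitBall d, v ∈ range (ballDeriv F u)}

/-- The random signs `σ` and the random selectors `δ` of a sparse Johnson-Lindenstrauss transform
with `m` rows, `n` columns and column sparsity `s`. -/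
structure IsSJLTData {Ω : Type*} [MeasurableSpace Ω] (μ : Measure Ω) (m n s : ℕ)
    (σ δ : Fin m → Fin n → Ω → ℝ) : Prop where
  measurable_sign : ∀ i j, Measurable (σ i j)
  measurable_sel : ∀ i j, Measurable (δ i j)
  sign_values : ∀ i j ω, σ i j ω = 1 ∨ σ i j ω = -1
  sign_prob_pos : ∀ i j, μ {ω | σ i j ω = 1} = 1 / 2
  sign_prob_neg : ∀ i j, μ {ω | σ i j ω = -1} = 1 / 2
  sign_indep : iIndepFun (fun (p : Fin m × Fin n) ω => σ p.1 p.2 ω) μ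
  sel_values : ∀ i j ω, δ i j ω = 0 ∨ δ i j ω = 1
  sel_mean : ∀ i j, ∫ ω, δ i j ω ∂μ = (s : ℝ) / m
  sel_neg_corr : ∀ (j : Fin n) (I : Finset (Fin m)),
    ∫ ω, ∏ i ∈ I, δ i j ω ∂μ ≤ ((s : ℝ) / m) ^ I.card
  sel_card : ∀ (j : Fin n) (ω : Ω), ∑ i, δ i j ω = s
  sel_indep : iIndepFun (fun (j : Fin n) ω (i : Fin m) => δ i j ω) μ
  sign_sel_indep : IndepFun (fun ω (p : Fin m × Fin n) => σ p.1 p.2 ω)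
    (fun ω (p : Fin m × Fin n) => δ p.1 p.2 ω) μ

/-- The sparse Johnson-Lindenstrauss matrix `Φᵢⱼ = s^{-1/2} σᵢⱼ δᵢⱼ`. -/
def sjltMatrix {Ω : Type*} {m n : ℕ} (s : ℕ) (σ δ : Fin m → Fin n → Ω → ℝ) (ω : Ω) :
    Matrix (Fin m) (Fin n) ℝ :=
  Matrix.of fun i j => 1 / √(s : ℝ) * σ i j ω * δ i j ω

/-- The linear map `ℓ₂ⁿ → ℓ₂ᵐ` given by the sparse Johnson-Lindenstrauss matrix. -/
def sjlt {Ω : Type*} {m n : ℕ} (s : ℕ) (σ δ : Fin m → Fin n → Ω → ℝ) (ω : Ω) :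
    EuclideanSpace ℝ (Fin n) →ₗ[ℝ] EuclideanSpace ℝ (Fin m) :=
  Matrix.toEuclideanLin (sjltMatrix s σ δ ω)

end

/-! Along a `C¹` curve in the manifold the velocity is tangent, so the hypothesis on tangent vectors
changes lengths by a factor in `[1 - ε, 1 + ε]`. What could fail is that the image contains `C¹`
curves that do not come from `C¹` curves of the manifold. This is excluded once `‖Φ (F u - F w)‖ ≥ c
‖u - w‖` on the ball for some `c > 0`: then `C¹` curves lift through `Φ ∘ F`
(`exists_lift_of_closedBall`, `geodesicDist_bounds`). The size of `c` does not enter the conclusion,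
so one event serves all `ε`.

It remains to bound `Φ` below on secants, with losses as large as `n ^ O(log n)` allowed. The
probabilistic input is the small ball estimate `IsSJLTData.measure_rows_lt_le`: for a fixed vector
with `k` entries of size at least `a`, where `s k ≤ m`, all unnormalized row sums are below `a` with
probability at most `exp (-s k / 15)`. A row that meets the large entries is small with conditional
probability at most `1/2`, and the negative correlation of the selectors controls the rows that miss
them.

Union bounds then suffice. By pigeonhole over `O(log n)` scales (`exists_row_ge`), every vector is
either, after rescaling, within `1` in each entry of an integer vector with at most `2k` nonzero
entries, about `k` or more of them large, or it has at least `m / s` entries that are not too small.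
The first kind costs entropy `O(k (log n)²)` against the exponent `s k`. The second is discretized
by nets of the secants and tangents, costing `O(d (log n)²)` against `m`. Very short secants are
compared with tangent vectors (`IsBiLipschitzParam.exists_row_ge_secant`). -/

/-! ### Calculus on the closed ball and lifting of `C¹` curves -/

section Geometry

variable {E G : Type*} [NormedAddCommGroup E] [NormedSpace ℝ E]
  [NormedAddCommGroup G] [NormedSpace ℝ G]

/-- First order Taylor estimate, with base point `u`, for a map with Lipschitz derivative. -/
theorem norm_sub_sub_fderiv_le {B : Set E} (hB : Convex ℝ B) {H : E → G} {H' : E → E →L[ℝ] G}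
    {K r : ℝ} (hK : 0 ≤ K) (hH : ∀ u ∈ B, HasFDerivWithinAt H (H' u) B u)
    (hH' : ∀ u ∈ B, ∀ w ∈ B, ‖H' u - H' w‖ ≤ K * ‖u - w‖) {u x y : E} (hu : u ∈ B)
    (hx : x ∈ B) (hy : y ∈ B) (hxu : ‖x - u‖ ≤ r) (hyu : ‖y - u‖ ≤ r) :
    ‖H y - H x - H' u (y - x)‖ ≤ K * r * ‖y - x‖ := by
  have hconv : Convex ℝ (B ∩ Metric.closedBall u r) := hB.inter (convex_closedBall u r)
  refine hconv.norm_image_sub_le_of_norm_hasFDerivWithin_le' (f' := H')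
    (fun z hz => (hH z hz.1).mono inter_subset_left) (fun z hz => ?_)
    ⟨hx, by simpa [dist_eq_norm] using hxu⟩ ⟨hy, by simpa [dist_eq_norm] using hyu⟩
  refine (hH' z hz.1 u hu).trans (mul_le_mul_of_nonneg_left ?_ hK)
  simpa [dist_eq_norm] using hz.2

/-- Every directional derivative on the closed unit ball is approximated by difference quotients
within the ball. -/
theorem exists_diff_approx_deriv_of_closedBall {H : E → G} {H' : E → E →L[ℝ] G} {K : ℝ} (hK : 0 ≤ K)
    (hH : ∀ u ∈ Metric.closedBall (0 : E) 1,
      HasFDerivWithinAt H (H' u) (Metric.closedBall (0 : E) 1) u)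
    (hH' : ∀ u ∈ Metric.closedBall (0 : E) 1, ∀ w ∈ Metric.closedBall (0 : E) 1,
      ‖H' u - H' w‖ ≤ K * ‖u - w‖) {u θ : E} (hu : u ∈ Metric.closedBall (0 : E) 1)
    (hθ : ‖θ‖ = 1) {t : ℝ} (ht : 0 < t) (ht1 : t < 1) :
    ∃ x ∈ Metric.closedBall (0 : E) 1, ∃ y ∈ Metric.closedBall (0 : E) 1,
      ‖y - x‖ = t ∧ ‖H y - H x - t • H' u θ‖ ≤ 2 * K * t * t := by
  have hu1 : ‖u‖ ≤ 1 := by simpa using hu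
  -- The base point is pulled inward to `(1 - t) u`, which leaves room for a step `t θ` in any
  -- direction even when `u` is on the boundary; both end points stay within `2 t` of `u`.
  have hx : ‖(1 - t) • u‖ ≤ 1 - t := by
    rw [norm_smul, Real.norm_of_nonneg (by linarith)]
    nlinarith
  have htθ : ‖t • θ‖ = t := by rw [norm_smul, Real.norm_of_nonneg ht.le, hθ, mul_one]
  have hxu : ‖(1 - t) • u - u‖ ≤ t := by
    have : (1 - t) • u - u = -(t • u) := by rw [sub_smul, one_smul]; abel
    rw [this, norm_neg, norm_smul, Real.norm_of_nonneg ht.le]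
    nlinarith
  have hxB : (1 - t) • u ∈ Metric.closedBall (0 : E) 1 := by simp; linarith
  have hyB : (1 - t) • u + t • θ ∈ Metric.closedBall (0 : E) 1 := by
    simp only [mem_closedBall_zero_iff]
    linarith [norm_add_le ((1 - t) • u) (t • θ)]
  refine ⟨_, hxB, _, hyB, by simpa using htθ, ?_⟩
  have := norm_sub_sub_fderiv_le (convex_closedBall (0 : E) 1) (r := 2 * t) hK hH hH' hu hxB hyB
    (by linarith) (by
      rw [add_sub_right_comm]
      linarith [norm_add_le ((1 - t) • u - u) (t • θ)])
  rw [add_sub_cancel_left, htθ, map_smul] at this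
  linarith

theorem le_of_forall_le_add_mul {a b M : ℝ} (h : ∀ t : ℝ, 0 < t → t < 1 → a ≤ b + M * t) :
    a ≤ b := by
  by_contra! hab
  set N := max M 1
  have hN : 1 ≤ N := le_max_right _ _
  set t := min (1 / 2) ((a - b) / (2 * N)) with ht
  have ht0 : 0 < t := lt_min (by norm_num) (div_pos (by linarith) (by linarith))
  have h1 := h t ht0 ((min_le_left _ _).trans_lt (by norm_num))
  have h2 : N * t ≤ (a - b) / 2 := by
    calc N * t ≤ N * ((a - b) / (2 * N)) := by gcongr; exact min_le_right _ _
      _ = _ := by field_simp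
  have h3 : M * t ≤ N * t := by gcongr; exact le_max_left _ _
  linarith

/-- The derivative of an expanding map of the closed unit ball is expanding. -/
theorem le_norm_deriv_of_closedBall {H : E → G} {H' : E → E →L[ℝ] G} {K c : ℝ} (hK : 0 ≤ K)
    (hH : ∀ u ∈ Metric.closedBall (0 : E) 1,
      HasFDerivWithinAt H (H' u) (Metric.closedBall (0 : E) 1) u)
    (hH' : ∀ u ∈ Metric.closedBall (0 : E) 1, ∀ w ∈ Metric.closedBall (0 : E) 1,
      ‖H' u - H' w‖ ≤ K * ‖u - w‖)
    (hc : ∀ u ∈ Metric.closedBall (0 : E) 1, ∀ w ∈ Metric.closedBall (0 : E) 1,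
      c * ‖u - w‖ ≤ ‖H u - H w‖) {u : E} (hu : u ∈ Metric.closedBall (0 : E) 1) (θ : E) :
    c * ‖θ‖ ≤ ‖H' u θ‖ := by
  have key : ∀ θ : E, ‖θ‖ = 1 → c ≤ ‖H' u θ‖ := by
    intro θ hθ
    refine le_of_forall_le_add_mul (M := 2 * K) fun t ht ht1 => ?_
    obtain ⟨x, hx, y, hy, hxy, h⟩ := exists_diff_approx_deriv_of_closedBall hK hH hH' hu hθ ht ht1
    have h1 := hc y hy x hx
    have h2 := norm_sub_norm_le (H y - H x) (t • H' u θ)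
    rw [norm_smul, Real.norm_of_nonneg ht.le] at h2
    rw [hxy] at h1
    nlinarith
  rcases eq_or_ne θ 0 with rfl | h0
  · simp
  have hn : 0 < ‖θ‖ := norm_pos_iff.2 h0
  have := key (‖θ‖⁻¹ • θ) (by rw [norm_smul, norm_inv, norm_norm, inv_mul_cancel₀ hn.ne'])
  rw [map_smul, norm_smul, norm_inv, norm_norm] at this
  rwa [← le_div_iff₀ hn, div_eq_inv_mul]

/-- The derivative of a Lipschitz map of the closed unit ball is bounded. -/
theorem norm_deriv_le_of_closedBall {H : E → G} {H' : E → E →L[ℝ] G} {K c : ℝ} (hK : 0 ≤ K)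
    (hH : ∀ u ∈ Metric.closedBall (0 : E) 1,
      HasFDerivWithinAt H (H' u) (Metric.closedBall (0 : E) 1) u)
    (hH' : ∀ u ∈ Metric.closedBall (0 : E) 1, ∀ w ∈ Metric.closedBall (0 : E) 1,
      ‖H' u - H' w‖ ≤ K * ‖u - w‖)
    (hc : ∀ u ∈ Metric.closedBall (0 : E) 1, ∀ w ∈ Metric.closedBall (0 : E) 1,
      ‖H u - H w‖ ≤ c * ‖u - w‖) {u : E} (hu : u ∈ Metric.closedBall (0 : E) 1) (θ : E) :
    ‖H' u θ‖ ≤ c * ‖θ‖ := by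
  have key : ∀ θ : E, ‖θ‖ = 1 → ‖H' u θ‖ ≤ c := by
    intro θ hθ
    refine le_of_forall_le_add_mul (M := 2 * K) fun t ht ht1 => ?_
    obtain ⟨x, hx, y, hy, hxy, h⟩ := exists_diff_approx_deriv_of_closedBall hK hH hH' hu hθ ht ht1
    have h1 := hc y hy x hx
    have h2 := norm_sub_norm_le (t • H' u θ) (H y - H x)
    rw [norm_smul, Real.norm_of_nonneg ht.le, norm_sub_rev (t • H' u θ)] at h2
    rw [hxy] at h1
    nlinarith
  rcases eq_or_ne θ 0 with rfl | h0
  · simp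
  have hn : 0 < ‖θ‖ := norm_pos_iff.2 h0
  have := key (‖θ‖⁻¹ • θ) (by rw [norm_smul, norm_inv, norm_norm, inv_mul_cancel₀ hn.ne'])
  rw [map_smul, norm_smul, norm_inv, norm_norm] at this
  rwa [← div_le_iff₀ hn, div_eq_inv_mul]

/-- A curve `β` in the ball is differentiable as soon as its image under an expanding map is. -/
theorem exists_hasDerivWithinAt_of_comp [FiniteDimensional ℝ G] {B : Set E} {H : E → G}
    {A : E →L[ℝ] G} {c : ℝ} (hc0 : 0 < c)
    (hc : ∀ u ∈ B, ∀ w ∈ B, c * ‖u - w‖ ≤ ‖H u - H w‖)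
    {I : Set ℝ} {β : ℝ → E} (hβ : MapsTo β I B) {t : ℝ} (ht : t ∈ I)
    (hA : HasFDerivWithinAt H A B (β t)) (hAc : ∀ θ, c * ‖θ‖ ≤ ‖A θ‖) {η' : G}
    (hη : HasDerivWithinAt (fun τ => H (β τ)) η' I t) :
    ∃ β', HasDerivWithinAt β β' I t := by
  have hinj : Function.Injective (A : E →ₗ[ℝ] G) := by
    refine (injective_iff_map_eq_zero _).2 fun θ h0 => ?_
    have := hAc θ
    simp only [ContinuousLinearMap.coe_coe] at h0
    rw [h0, norm_zero] at this
    exact norm_eq_zero.1 (le_antisymm (by nlinarith [norm_nonneg θ]) (norm_nonneg θ))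
  -- Expansion of `H` turns differentiability of `H ∘ β` into a Lipschitz bound for `β` at `t`, so
  -- the Taylor remainder of `H` along `β` is `o(τ - t)`.
  have hbig : (fun τ => β τ - β t) =O[nhdsWithin t I] fun τ => τ - t := by
    have h1 : (fun τ => H (β τ) - H (β t)) =O[nhdsWithin t I] fun τ => τ - t :=
      hη.differentiableWithinAt.isBigO_sub
    refine Asymptotics.IsBigO.trans (.of_bound c⁻¹ ?_) h1
    filter_upwards [self_mem_nhdsWithin] with τ hτ
    rw [inv_mul_eq_div, le_div_iff₀ hc0, mul_comm]
    exact hc _ (hβ hτ) _ (hβ ht)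
  have hcont : Filter.Tendsto β (nhdsWithin t I) (nhdsWithin (β t) B) := by
    refine tendsto_nhdsWithin_iff.2 ⟨?_, ?_⟩
    · have h0 : Filter.Tendsto (fun τ : ℝ => τ - t) (nhdsWithin t I) (nhds 0) := by
        have : Filter.Tendsto (fun τ : ℝ => τ - t) (nhds t) (nhds (t - t)) :=
          (continuous_id.sub continuous_const).tendsto t
        rw [sub_self] at this
        exact this.mono_left nhdsWithin_le_nhds
      have := (hbig.trans_tendsto h0).add_const (β t)
      simpa using this
    · filter_upwards [self_mem_nhdsWithin] with τ hτ using hβ hτ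
  have hlit : (fun τ => H (β τ) - H (β t) - A (β τ - β t)) =o[nhdsWithin t I]
      fun τ => τ - t :=
    (hA.isLittleO.comp_tendsto hcont).trans_isBigO hbig
  have hlit2 : (fun τ => A (β τ - β t) - (τ - t) • η') =o[nhdsWithin t I] fun τ => τ - t := by
    have h2 := (hasDerivWithinAt_iff_isLittleO.1 hη).sub hlit
    refine h2.congr_left fun τ => ?_
    abel
  -- A left inverse of `A`, continuous because `G` is finite-dimensional, recovers the increment of
  -- `β` and gives the derivative `R η'`.
  obtain ⟨R, hR⟩ := LinearMap.exists_leftInverse_of_injective (A : E →ₗ[ℝ] G)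
    (LinearMap.ker_eq_bot.2 hinj)
  refine ⟨R η', hasDerivWithinAt_iff_isLittleO.2
    ((((LinearMap.toContinuousLinearMap R).isBigO_comp _ _).trans_isLittleO hlit2).congr_left
      fun τ => ?_)⟩
  have := LinearMap.congr_fun hR (β τ - β t)
  simp only [LinearMap.comp_apply, ContinuousLinearMap.coe_coe, LinearMap.id_apply] at this
  simp [map_sub, map_smul] at this ⊢
  rw [this]

/-- `C¹` curves lift through an expanding map with Lipschitz derivative. -/
theorem exists_lift_of_closedBall [FiniteDimensional ℝ G] {H : E → G} {H' : E → E →L[ℝ] G}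
    {K c : ℝ} (hK : 0 ≤ K) (hc0 : 0 < c)
    (hH : ∀ u ∈ Metric.closedBall (0 : E) 1,
      HasFDerivWithinAt H (H' u) (Metric.closedBall (0 : E) 1) u)
    (hH' : ∀ u ∈ Metric.closedBall (0 : E) 1, ∀ w ∈ Metric.closedBall (0 : E) 1,
      ‖H' u - H' w‖ ≤ K * ‖u - w‖)
    (hc : ∀ u ∈ Metric.closedBall (0 : E) 1, ∀ w ∈ Metric.closedBall (0 : E) 1,
      c * ‖u - w‖ ≤ ‖H u - H w‖) {x y : G} {η : ℝ → G}
    (hη : IsC1CurveIn (H '' Metric.closedBall (0 : E) 1) x y η) :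
    ∃ β β' : ℝ → E, MapsTo β (Icc 0 1) (Metric.closedBall 0 1) ∧
      ContinuousOn β' (Icc 0 1) ∧ ContinuousOn β (Icc 0 1) ∧
      ∀ t ∈ Icc (0 : ℝ) 1, H (β t) = η t ∧ HasDerivWithinAt β (β' t) (Icc 0 1) t ∧
        H' (β t) (β' t) = derivWithin η (Icc 0 1) t := by
  obtain ⟨hd, hcont⟩ := (contDiffOn_one_iff_derivWithin (uniqueDiffOn_Icc zero_lt_one)).1
    hη.contDiffOn
  have hex : ∀ t, ∃ u, t ∈ Icc (0 : ℝ) 1 → u ∈ Metric.closedBall (0 : E) 1 ∧ H u = η t := by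
    intro t
    by_cases ht : t ∈ Icc (0 : ℝ) 1
    · obtain ⟨u, hu, h⟩ := hη.mapsTo ht
      exact ⟨u, fun _ => ⟨hu, h⟩⟩
    · exact ⟨0, fun h => absurd h ht⟩
  choose β hβ using hex
  have hβm : MapsTo β (Icc 0 1) (Metric.closedBall 0 1) := fun t ht => (hβ t ht).1
  have hder : ∀ t, ∃ β', t ∈ Icc (0 : ℝ) 1 → HasDerivWithinAt β β' (Icc 0 1) t := by
    intro t
    by_cases ht : t ∈ Icc (0 : ℝ) 1
    · have h1 : HasDerivWithinAt (fun τ => H (β τ)) (derivWithin η (Icc 0 1) t) (Icc 0 1) t :=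
        (hd t ht).hasDerivWithinAt.congr (fun τ hτ => (hβ τ hτ).2) (hβ t ht).2
      obtain ⟨β', h⟩ := exists_hasDerivWithinAt_of_comp hc0 hc hβm ht (hH _ (hβm ht))
        (le_norm_deriv_of_closedBall hK hH hH' hc (hβm ht)) h1
      exact ⟨β', fun _ => h⟩
    · exact ⟨0, fun h => absurd h ht⟩
  choose β' hβ' using hder
  have hβc : ContinuousOn β (Icc 0 1) := fun t ht => (hβ' t ht).continuousWithinAt
  have heq : ∀ t ∈ Icc (0 : ℝ) 1, H' (β t) (β' t) = derivWithin η (Icc 0 1) t := by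
    intro t ht
    have h1 := (hH _ (hβm ht)).comp_hasDerivWithinAt t (hβ' t ht) hβm
    have h2 : HasDerivWithinAt (H ∘ β) (derivWithin η (Icc 0 1) t) (Icc 0 1) t :=
      (hd t ht).hasDerivWithinAt.congr (fun τ hτ => (hβ τ hτ).2) (hβ t ht).2
    exact (uniqueDiffOn_Icc zero_lt_one t ht).eq_deriv _ h1 h2
  refine ⟨β, β', hβm, fun t ht => ?_, hβc, fun t ht => ⟨(hβ t ht).2, hβ' t ht, heq t ht⟩⟩
  have hH'c : ContinuousOn (fun τ => H' (β τ)) (Icc 0 1) := by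
    refine ContinuousOn.comp (t := Metric.closedBall 0 1) ?_ hβc hβm
    refine (LipschitzOnWith.of_dist_le_mul (K := ⟨K, hK⟩) fun u hu w hw => ?_).continuousOn
    rw [dist_eq_norm, dist_eq_norm]
    exact hH' u hu w hw
  -- Continuity of `β'` at `t`: expansion bounds `c ‖β' τ - β' t‖` by `‖H' (β τ) (β' τ - β' t)‖`,
  -- which is the norm here.
  have hlim : Filter.Tendsto (fun τ => c⁻¹ * ‖derivWithin η (Icc 0 1) τ - H' (β τ) (β' t)‖)
      (nhdsWithin t (Icc 0 1)) (nhds 0) := by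
    have h1 := ((hcont t ht).sub ((hH'c t ht).clm_apply continuousWithinAt_const
      (g := fun _ => β' t))).norm.const_mul c⁻¹ |>.tendsto
    simpa [heq t ht] using h1
  rw [ContinuousWithinAt, tendsto_iff_norm_sub_tendsto_zero]
  refine squeeze_zero' (.of_forall fun _ => norm_nonneg _) ?_ hlim
  filter_upwards [self_mem_nhdsWithin] with τ hτ
  rw [inv_mul_eq_div, le_div_iff₀ hc0, mul_comm, ← heq τ hτ, ← map_sub]
  exact le_norm_deriv_of_closedBall hK hH hH' hc (hβm hτ) _

end Geometry

/-! ### From an expanding parametrization to geodesic distances -/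

section Geodesic

variable {d n m : ℕ} {κ : ℝ} {F : EuclideanSpace ℝ (Fin d) → EuclideanSpace ℝ (Fin n)}

theorem IsBiLipschitzParam.hasFDerivWithinAt (hF : IsBiLipschitzParam κ F)
    {u : EuclideanSpace ℝ (Fin d)} (hu : u ∈ unitBall d) :
    HasFDerivWithinAt F (ballDeriv F u) (unitBall d) u :=
  (hF.differentiableOn u hu).hasFDerivWithinAt

theorem IsBiLipschitzParam.le_norm_ballDeriv (hF : IsBiLipschitzParam κ F) (hκ : 0 ≤ κ)
    {u : EuclideanSpace ℝ (Fin d)} (hu : u ∈ unitBall d) (θ : EuclideanSpace ℝ (Fin d)) :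
    κ⁻¹ * ‖θ‖ ≤ ‖ballDeriv F u θ‖ :=
  le_norm_deriv_of_closedBall hκ (fun _ h => hF.hasFDerivWithinAt h) hF.deriv_lipschitz
    hF.le_dist hu θ

theorem IsBiLipschitzParam.norm_ballDeriv_le (hF : IsBiLipschitzParam κ F) (hκ : 0 ≤ κ)
    {u : EuclideanSpace ℝ (Fin d)} (hu : u ∈ unitBall d) (θ : EuclideanSpace ℝ (Fin d)) :
    ‖ballDeriv F u θ‖ ≤ κ * ‖θ‖ :=
  norm_deriv_le_of_closedBall hκ (fun _ h => hF.hasFDerivWithinAt h) hF.deriv_lipschitz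
    hF.dist_le hu θ

/-- Norm estimates on unit tangent vectors extend to all tangent vectors. -/
theorem norm_bounds_of_unitTangentVectors
    {Φ : EuclideanSpace ℝ (Fin n) →ₗ[ℝ] EuclideanSpace ℝ (Fin m)} {ε : ℝ}
    (h : ∀ v ∈ unitTangentVectors F, 1 - ε ≤ ‖Φ v‖ ∧ ‖Φ v‖ ≤ 1 + ε)
    {u : EuclideanSpace ℝ (Fin d)} (hu : u ∈ unitBall d) (θ : EuclideanSpace ℝ (Fin d)) :
    (1 - ε) * ‖ballDeriv F u θ‖ ≤ ‖Φ (ballDeriv F u θ)‖ ∧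
      ‖Φ (ballDeriv F u θ)‖ ≤ (1 + ε) * ‖ballDeriv F u θ‖ := by
  rcases eq_or_ne (ballDeriv F u θ) 0 with h0 | h0
  · simp [h0]
  have hn : 0 < ‖ballDeriv F u θ‖ := norm_pos_iff.2 h0
  have := h (‖ballDeriv F u θ‖⁻¹ • ballDeriv F u θ)
    ⟨by rw [norm_smul, norm_inv, norm_norm, inv_mul_cancel₀ hn.ne'],
      u, hu, ‖ballDeriv F u θ‖⁻¹ • θ, by rw [map_smul]⟩
  rw [map_smul, norm_smul, norm_inv, norm_norm, inv_mul_eq_div, le_div_iff₀ hn,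
    div_le_iff₀ hn] at this
  exact this

theorem mul_curveLength_le {E₁ E₂ : Type*} [NormedAddCommGroup E₁] [NormedSpace ℝ E₁]
    [NormedAddCommGroup E₂] [NormedSpace ℝ E₂] {γ : ℝ → E₁} {η : ℝ → E₂} {a b : ℝ} (ha : 0 ≤ a)
    (hb : 0 ≤ b)
    (h : ∀ t ∈ Icc (0 : ℝ) 1,
      a * ‖derivWithin γ (Icc 0 1) t‖ ≤ b * ‖derivWithin η (Icc 0 1) t‖) :
    ENNReal.ofReal a * curveLength γ ≤ ENNReal.ofReal b * curveLength η := by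
  unfold curveLength
  rw [← lintegral_const_mul' _ _ ENNReal.ofReal_ne_top,
    ← lintegral_const_mul' _ _ ENNReal.ofReal_ne_top]
  refine setLIntegral_mono' measurableSet_Icc fun t ht => ?_
  rw [← ofReal_norm, ← ofReal_norm, ← ENNReal.ofReal_mul ha,
    ← ENNReal.ofReal_mul hb]
  exact ENNReal.ofReal_le_ofReal (h t ht)

/-- A linear map whose restriction to `F (unitBall d)` is bi-Lipschitz, and which almost preserves
the norms of the tangent vectors, almost preserves geodesic distances. -/
theorem geodesicDist_bounds (hκ : 0 < κ) (hF : IsBiLipschitzParam κ F)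
    (Φ : EuclideanSpace ℝ (Fin n) →ₗ[ℝ] EuclideanSpace ℝ (Fin m)) {c : ℝ} (hc0 : 0 < c)
    (hc : ∀ u ∈ unitBall d, ∀ w ∈ unitBall d, c * ‖u - w‖ ≤ ‖Φ (F u - F w)‖)
    {ε : ℝ} (hε : 0 < ε) (hε1 : ε < 1)
    (h : ∀ v ∈ unitTangentVectors F, 1 - ε ≤ ‖Φ v‖ ∧ ‖Φ v‖ ≤ 1 + ε)
    {x y : EuclideanSpace ℝ (Fin n)} (hx : x ∈ F '' unitBall d) (hy : y ∈ F '' unitBall d) :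
    ENNReal.ofReal (1 - ε) * geodesicDist (F '' unitBall d) x y ≤
        geodesicDist (Φ '' (F '' unitBall d)) (Φ x) (Φ y) ∧
      geodesicDist (Φ '' (F '' unitBall d)) (Φ x) (Φ y) ≤
        ENNReal.ofReal (1 + ε) * geodesicDist (F '' unitBall d) x y := by
  set Ψ : EuclideanSpace ℝ (Fin n) →L[ℝ] EuclideanSpace ℝ (Fin m) :=
    LinearMap.toContinuousLinearMap Φ with hΨ
  have hΨΦ : ∀ v, Ψ v = Φ v := fun v => rfl
  constructor
  · refine le_iInf₂ fun η hη => ?_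
    have hη' : IsC1CurveIn ((fun u => Ψ (F u)) '' Metric.closedBall 0 1) (Φ x) (Φ y) η := by
      have : (fun u => Ψ (F u)) '' Metric.closedBall 0 1 = Φ '' (F '' unitBall d) := by
        rw [image_image]; rfl
      rwa [this]
    obtain ⟨β, β', hβm, hβ'c, hβc, hβ⟩ := exists_lift_of_closedBall (H := fun u => Ψ (F u))
      (H' := fun u => Ψ.comp (ballDeriv F u)) (K := ‖Ψ‖ * κ) (c := c) (by positivity) hc0
      (fun u hu => Ψ.hasFDerivAt.comp_hasFDerivWithinAt u (hF.hasFDerivWithinAt hu))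
      (fun u hu w hw => by
        rw [← ContinuousLinearMap.comp_sub, mul_assoc]
        exact (ContinuousLinearMap.opNorm_comp_le _ _).trans
          (mul_le_mul_of_nonneg_left (hF.deriv_lipschitz u hu w hw) (norm_nonneg _)))
      (fun u hu w hw => by
        rw [← map_sub]
        exact hc u hu w hw) hη'
    have hder : ∀ t ∈ Icc (0 : ℝ) 1,
        HasDerivWithinAt (F ∘ β) (ballDeriv F (β t) (β' t)) (Icc 0 1) t := fun t ht =>
      (hF.hasFDerivWithinAt (hβm ht)).comp_hasDerivWithinAt t (hβ t ht).2.1 hβm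
    have hderiv : ∀ t ∈ Icc (0 : ℝ) 1,
        derivWithin (F ∘ β) (Icc 0 1) t = ballDeriv F (β t) (β' t) := fun t ht =>
      (hder t ht).derivWithin (uniqueDiffOn_Icc zero_lt_one t ht)
    -- Injectivity of `Φ` on the manifold; it forces the lifted curve to end at `x` and `y`
    -- themselves.
    have hinj : ∀ t ∈ Icc (0 : ℝ) 1, ∀ z ∈ F '' unitBall d, η t = Φ z → (F ∘ β) t = z := by
      rintro t ht _ ⟨u, hu, rfl⟩ he
      have h1 := hc _ (hβm ht) u hu
      rw [map_sub, ← hΨΦ, (hβ t ht).1, he, sub_self, norm_zero] at h1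
      have : ‖β t - u‖ = 0 := le_antisymm (by nlinarith [norm_nonneg (β t - u)]) (norm_nonneg _)
      rw [Function.comp_apply, sub_eq_zero.1 (norm_eq_zero.1 this)]
    have hγ : IsC1CurveIn (F '' unitBall d) x y (F ∘ β) := by
      refine ⟨(contDiffOn_one_iff_derivWithin (uniqueDiffOn_Icc zero_lt_one)).2
        ⟨fun t ht => (hder t ht).differentiableWithinAt, ?_⟩,
        fun t ht => mem_image_of_mem _ (hβm ht),
        hinj 0 (by simp) x hx hη.source, hinj 1 (by simp) y hy hη.target⟩
      refine ContinuousOn.congr ?_ hderiv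
      refine ContinuousOn.clm_apply (ContinuousOn.comp (t := unitBall d) ?_ hβc hβm) hβ'c
      refine (LipschitzOnWith.of_dist_le_mul (K := ⟨κ, hκ.le⟩) fun u hu w hw => ?_).continuousOn
      rw [dist_eq_norm, dist_eq_norm]
      exact hF.deriv_lipschitz u hu w hw
    refine (mul_le_mul_right (iInf₂_le _ hγ) _).trans ?_
    have := mul_curveLength_le (γ := F ∘ β) (η := η) (a := 1 - ε) (b := 1) (by linarith)
      zero_le_one fun t ht => by
        rw [hderiv t ht, ← (hβ t ht).2.2, one_mul]
        exact (norm_bounds_of_unitTangentVectors h (hβm ht) _).1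
    simpa using this
  · unfold geodesicDist
    rw [ENNReal.mul_iInf_of_ne (by simp; linarith) ENNReal.ofReal_ne_top]
    refine le_iInf fun γ => ?_
    rw [ENNReal.mul_iInf_of_ne (by simp; linarith) ENNReal.ofReal_ne_top]
    refine le_iInf fun hγ => ?_
    -- The curve already lies in the manifold; lifting it through `F` serves to show that its
    -- velocity is in the range of `ballDeriv F`.
    obtain ⟨β, β', hβm, -, -, hβ⟩ := exists_lift_of_closedBall (H := F)
      (H' := ballDeriv F) hκ.le (inv_pos.2 hκ) (fun u hu => hF.hasFDerivWithinAt hu)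
      hF.deriv_lipschitz hF.le_dist hγ
    have hΨγ : IsC1CurveIn (Φ '' (F '' unitBall d)) (Φ x) (Φ y) (Ψ ∘ γ) :=
      ⟨Ψ.contDiff.comp_contDiffOn hγ.contDiffOn,
        fun t ht => mem_image_of_mem _ (hγ.mapsTo ht),
        congrArg Φ hγ.source, congrArg Φ hγ.target⟩
    refine (iInf₂_le _ hΨγ).trans ?_
    have := mul_curveLength_le (γ := Ψ ∘ γ) (η := γ) (a := 1) (b := 1 + ε) zero_le_one
      (by linarith) fun t ht => by
        have hd := (hγ.contDiffOn.differentiableOn one_ne_zero t ht).hasDerivWithinAt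
        have h1 := (Ψ.hasFDerivAt.comp_hasDerivWithinAt t hd).derivWithin
          (uniqueDiffOn_Icc zero_lt_one t ht)
        rw [h1, one_mul, ← (hβ t ht).2.2]
        exact (norm_bounds_of_unitTangentVectors h (hβm ht) _).2
    simpa using this

end Geodesic

/-! ### The small ball estimate for a fixed vector -/

section SmallBall

/-- The sign `±1` encoded by a Boolean. -/
def boolSign (b : Bool) : ℝ := if b then 1 else -1

/-- At most half of the signed sums of a vector with an entry of size at least `a` lie in
`(-a, a)`. -/
theorem two_mul_card_abs_sum_lt_le {n : ℕ} (w : Fin n → ℝ) {a : ℝ} {j : Fin n} (hj : a ≤ |w j|) :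
    2 * (Finset.univ.filter fun x : Fin n → Bool => |∑ j, boolSign (x j) * w j| < a).card
      ≤ 2 ^ n := by
  classical
  set P := Finset.univ.filter fun x : Fin n → Bool => |∑ j, boolSign (x j) * w j| < a with hP
  -- Flipping the `j`-th sign moves the sum by `2 |w j| ≥ 2 a`, so `x` and `flip x` cannot both give
  -- a value in `(-a, a)`.
  let flip : (Fin n → Bool) → (Fin n → Bool) := fun x => Function.update x j (!(x j))
  have hflip : ∀ x, flip (flip x) = x := fun x => by simp [flip]
  have hinj : Function.Injective flip := fun x y h => by rw [← hflip x, h, hflip]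
  have hsum : ∀ x, ∑ i, boolSign (flip x i) * w i
      = ∑ i, boolSign (x i) * w i - 2 * (boolSign (x j) * w j) := by
    intro x
    rw [← Finset.add_sum_erase _ _ (Finset.mem_univ j),
      ← Finset.add_sum_erase _ (fun i => boolSign (x i) * w i) (Finset.mem_univ j)]
    have h1 : ∑ i ∈ Finset.univ.erase j, boolSign (flip x i) * w i
        = ∑ i ∈ Finset.univ.erase j, boolSign (x i) * w i :=
      Finset.sum_congr rfl fun i hi => by
        simp [flip, Function.update_of_ne (Finset.ne_of_mem_erase hi)]
    have h2 : boolSign (flip x j) = -boolSign (x j) := by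
      cases hx : x j <;> simp [flip, boolSign, hx]
    rw [h1, h2]
    ring
  have hdisj : Disjoint P (P.image flip) := by
    rw [Finset.disjoint_left]
    intro x hx hx'
    obtain ⟨y, hy, rfl⟩ := Finset.mem_image.1 hx'
    rw [hP, Finset.mem_filter] at hx hy
    have h1 := hx.2
    have h2 := hy.2
    rw [hsum] at h1
    have h3 : |boolSign (y j) * w j| = |w j| := by
      cases y j <;> simp [boolSign]
    rw [abs_lt] at h1 h2
    rw [← h3] at hj
    rcases le_abs.1 hj with h | h <;> linarith
  have := Finset.card_le_univ (P ∪ P.image flip)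
  rw [Finset.card_union_of_disjoint hdisj, Finset.card_image_of_injective _ hinj] at this
  simp at this
  omega

/-- With the selectors frozen, the rows decouple: a row that selects some `j ∈ S` contributes a
factor at most `1/2`, any other row at most `1`. The product over `S` is the indicator that row `i`
misses `S`. -/
theorem card_signs_le {m n : ℕ} (D : Fin m → Fin n → ℝ) (hD : ∀ i j, D i j = 0 ∨ D i j = 1)
    {z : Fin n → ℝ} {a : ℝ} {S : Finset (Fin n)} (hS : ∀ j ∈ S, a ≤ |z j|) :
    ((Finset.univ.filter fun x : Fin m → Fin n → Bool =>
        ∀ i, |∑ j, boolSign (x i j) * (D i j * z j)| < a).card : ℝ)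
      ≤ 2 ^ (m * n) * ((1 / 2) ^ m * ∏ i, (1 + ∏ j ∈ S, (1 - D i j))) := by
  classical
  have h1 : (Finset.univ.filter fun x : Fin m → Fin n → Bool =>
      ∀ i, |∑ j, boolSign (x i j) * (D i j * z j)| < a) =
      Fintype.piFinset fun i => Finset.univ.filter fun x : Fin n → Bool =>
        |∑ j, boolSign (x j) * (D i j * z j)| < a := by
    ext x; simp
  rw [h1, Fintype.card_piFinset]
  push_cast
  have h2 : (2 : ℝ) ^ (m * n) * ((1 / 2) ^ m * ∏ i, (1 + ∏ j ∈ S, (1 - D i j)))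
      = ∏ i, (2 ^ n * ((1 / 2) * (1 + ∏ j ∈ S, (1 - D i j)))) := by
    simp [Finset.prod_mul_distrib, ← pow_mul, mul_comm]
  rw [h2]
  refine Finset.prod_le_prod (fun _ _ => by positivity) fun i _ => ?_
  by_cases hi : ∃ j ∈ S, D i j = 1
  · obtain ⟨j, hj, hij⟩ := hi
    rw [Finset.prod_eq_zero hj (by rw [hij, sub_self])]
    have := two_mul_card_abs_sum_lt_le (fun j => D i j * z j) (a := a) (j := j)
      (by simpa [hij] using hS j hj)
    have h3 : (2 : ℝ) * ((Finset.univ.filter fun x : Fin n → Bool =>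
      |∑ j, boolSign (x j) * (D i j * z j)| < a).card : ℝ) ≤ 2 ^ n := by exact_mod_cast this
    linarith
  · push Not at hi
    rw [Finset.prod_eq_one fun j hj => by rw [(hD i j).resolve_right (hi j hj), sub_zero]]
    have := Finset.card_le_univ (Finset.univ.filter fun x : Fin n → Bool =>
      |∑ j, boolSign (x j) * (D i j * z j)| < a)
    simp only [Fintype.card_pi, Fintype.card_bool, Finset.prod_const, Finset.card_univ,
      Fintype.card_fin] at this
    have h3 : ((Finset.univ.filter fun x : Fin n → Bool =>
      |∑ j, boolSign (x j) * (D i j * z j)| < a).card : ℝ) ≤ 2 ^ n := by exact_mod_cast this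
    linarith

/-- The assumption on the selectors bounds moments of products of `δ`, not of `1 - δ`. Since column
`j` has exactly `s` ones, `∏ i, (1 + D i j) = 2 ^ s`; together with `(1 - D) (1 + D) ≤ 1` this
trades the factors `1 - D` over `W` for factors `1 + D` over `Wᶜ`, whose expansion has nonnegative
coefficients. -/
theorem half_pow_mul_prod_le {m n s : ℕ} (D : Fin m → Fin n → ℝ)
    (hD : ∀ i j, D i j = 0 ∨ D i j = 1) (hs : ∀ j, ∑ i, D i j = s) (S : Finset (Fin n)) :
    ∏ i, (1 + ∏ j ∈ S, (1 - D i j))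
      ≤ ((1 / 2) ^ s) ^ S.card * ∑ W : Finset (Fin m), ∏ j ∈ S, ∏ i ∈ Wᶜ, (1 + D i j) := by
  classical
  rw [Finset.prod_one_add, Finset.mul_sum, Finset.powerset_univ]
  refine Finset.sum_le_sum fun W _ => ?_
  rw [Finset.prod_comm, ← Finset.prod_const, ← Finset.prod_mul_distrib]
  have hnn : ∀ i j, 0 ≤ 1 - D i j := fun i j => by rcases hD i j with h | h <;> simp [h]
  have hnn' : ∀ i j, 0 ≤ 1 + D i j := fun i j => by rcases hD i j with h | h <;> norm_num [h]
  refine Finset.prod_le_prod (fun j _ => Finset.prod_nonneg fun i _ => hnn i j) fun j _ => ?_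
  have h2 : (∏ i ∈ W, (1 + D i j)) * ∏ i ∈ Wᶜ, (1 + D i j) = 2 ^ s := by
    rw [Finset.prod_mul_prod_compl]
    have h3 : ∀ i, 1 + D i j = (2 : ℝ) ^ (D i j) := fun i => by
      rcases hD i j with h | h <;> norm_num [h]
    simp_rw [h3]
    rw [← Real.rpow_sum_of_pos two_pos, hs, Real.rpow_natCast]
  have h4 : (∏ i ∈ W, (1 - D i j)) * ∏ i ∈ W, (1 + D i j) ≤ 1 := by
    rw [← Finset.prod_mul_distrib]
    refine Finset.prod_le_one (fun i _ => mul_nonneg (hnn i j) (hnn' i j)) fun i _ => ?_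
    rcases hD i j with h | h <;> simp [h]
  have h5 : ∏ i ∈ W, (1 - D i j)
      = (1 / 2) ^ s * (((∏ i ∈ W, (1 - D i j)) * ∏ i ∈ W, (1 + D i j)) *
        ∏ i ∈ Wᶜ, (1 + D i j)) := by
    rw [mul_assoc, h2]
    rw [mul_comm (∏ i ∈ W, (1 - D i j)), ← mul_assoc, ← mul_pow]; norm_num
  rw [h5]
  refine mul_le_mul_of_nonneg_left ?_ (by positivity)
  exact mul_le_of_le_one_left (Finset.prod_nonneg fun i _ => hnn' i j) h4

variable {Ω : Type*} [MeasurableSpace Ω] {μ : Measure Ω} {m n s : ℕ}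
  {σ δ : Fin m → Fin n → Ω → ℝ}

theorem IsSJLTData.measure_sign_eq (h : IsSJLTData μ m n s σ δ) (x : Fin m → Fin n → Bool) :
    μ.real {ω | ∀ i j, σ i j ω = boolSign (x i j)} = (1 / 2) ^ (m * n) := by
  have h1 := h.sign_indep.measure_inter_preimage_eq_mul Finset.univ
    (sets := fun p => {boolSign (x p.1 p.2)}) (fun _ _ => measurableSet_singleton _)
  have h2 : {ω | ∀ i j, σ i j ω = boolSign (x i j)} =
      ⋂ p ∈ (Finset.univ : Finset (Fin m × Fin n)),
        (fun ω => σ p.1 p.2 ω) ⁻¹' {boolSign (x p.1 p.2)} := by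
    ext ω; simp
  have h3 : ∀ p : Fin m × Fin n,
      μ ((fun ω => σ p.1 p.2 ω) ⁻¹' {boolSign (x p.1 p.2)}) = 1 / 2 := by
    intro p
    cases hx : x p.1 p.2
    · exact h.sign_prob_neg p.1 p.2
    · exact h.sign_prob_pos p.1 p.2
  rw [Measure.real, h2, h1, Finset.prod_congr rfl fun p _ => h3 p]
  simp

theorem IsSJLTData.integral_prod_one_add_le [IsProbabilityMeasure μ]
    (h : IsSJLTData μ m n s σ δ) (j : Fin n)
    (W : Finset (Fin m)) :
    ∫ ω, ∏ i ∈ W, (1 + δ i j ω) ∂μ ≤ (1 + (s : ℝ) / m) ^ W.card := by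
  classical
  simp_rw [Finset.prod_one_add]
  rw [integral_finsetSum]
  · rw [← Finset.prod_const, Finset.prod_one_add]
    refine Finset.sum_le_sum fun I _ => ?_
    rw [Finset.prod_const]
    exact h.sel_neg_corr j I
  · intro I _
    refine Integrable.of_bound (C := 1)
      (Finset.measurable_fun_prod _ fun i _ => h.measurable_sel i j).aestronglyMeasurable
      (.of_forall fun ω => ?_)
    rw [norm_prod]
    refine Finset.prod_le_one (fun _ _ => norm_nonneg _) fun i _ => ?_
    rcases h.sel_values i j ω with h | h <;> simp [h]

theorem IsSJLTData.integrable_prod_prod [IsProbabilityMeasure μ]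
    (h : IsSJLTData μ m n s σ δ) (S : Finset (Fin n))
    (W : Finset (Fin m)) :
    Integrable (fun ω => ∏ j ∈ S, ∏ i ∈ W, (1 + δ i j ω)) μ := by
  refine Integrable.of_bound (C := ∏ j ∈ S, ∏ i ∈ W, 2)
      (Finset.measurable_fun_prod _ fun j _ => Finset.measurable_fun_prod _ fun i _ =>
        measurable_const.add (h.measurable_sel i j)).aestronglyMeasurable
      (.of_forall fun ω => ?_)
  rw [norm_prod]
  refine Finset.prod_le_prod (fun _ _ => norm_nonneg _) fun j _ => ?_
  rw [norm_prod]
  refine Finset.prod_le_prod (fun _ _ => norm_nonneg _) fun i _ => ?_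
  rcases h.sel_values i j ω with h | h <;> norm_num [h]

theorem IsSJLTData.integral_prod_prod_le [IsProbabilityMeasure μ]
    (h : IsSJLTData μ m n s σ δ) (S : Finset (Fin n))
    (W : Finset (Fin m)) :
    ∫ ω, ∏ j ∈ S, ∏ i ∈ W, (1 + δ i j ω) ∂μ ≤ ((1 + (s : ℝ) / m) ^ S.card) ^ W.card := by
  classical
  have h1 := h.sel_indep.integral_fun_prod_comp
    -- The factor `1` off `S` lets the independence of all columns be applied at once.
    (f := fun j x => if j ∈ S then ∏ i ∈ W, (1 + x i) else 1)
    (fun j => (measurable_pi_lambda _ fun i => h.measurable_sel i j).aemeasurable)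
    (fun j => by
      refine Measurable.aestronglyMeasurable ?_
      split_ifs
      · exact Finset.measurable_fun_prod _ fun i _ => measurable_const.add (measurable_pi_apply i)
      · exact measurable_const)
  have h2 : ∀ j, ∫ ω, (if j ∈ S then ∏ i ∈ W, (1 + δ i j ω) else 1) ∂μ
      = if j ∈ S then ∫ ω, ∏ i ∈ W, (1 + δ i j ω) ∂μ else 1 := by
    intro j
    split_ifs <;> simp
  simp only [h2, Finset.prod_ite_mem, Finset.univ_inter] at h1
  rw [h1, pow_right_comm, ← Finset.prod_const]
  refine Finset.prod_le_prod (fun j _ => integral_nonneg fun ω => ?_)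
    fun j _ => h.integral_prod_one_add_le j W
  refine Finset.prod_nonneg fun i _ => ?_
  rcases h.sel_values i j ω with h | h <;> norm_num [h]

/-- Each of the `2 ^ (m n)` sign patterns has probability `2 ^ (-m n)` and is independent of the
selectors, so the probability is the mean of the count in `card_signs_le`. The sum over row sets `W`
collapses by the binomial theorem. -/
theorem IsSJLTData.measure_rows_lt_le_aux [IsProbabilityMeasure μ]
    (h : IsSJLTData μ m n s σ δ) {z : Fin n → ℝ} {a : ℝ}
    {S : Finset (Fin n)} (hS : ∀ j ∈ S, a ≤ |z j|) :
    μ.real {ω | ∀ i, |∑ j, σ i j ω * δ i j ω * z j| < a}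
      ≤ (1 / 2) ^ m * (((1 / 2) ^ s) ^ S.card * (1 + (1 + (s : ℝ) / m) ^ S.card) ^ m) := by
  classical
  set T : (Fin m → Fin n → Bool) → Set Ω := fun x =>
    {ω | ∀ i, |∑ j, boolSign (x i j) * (δ i j ω * z j)| < a} with hT
  have hTm : ∀ x, MeasurableSet (T x) := by
    intro x
    rw [hT]
    simp only [ofPred_forall]
    refine MeasurableSet.iInter fun i => measurableSet_lt ?_ measurable_const
    exact Measurable.abs (Finset.measurable_fun_sum _ fun j _ =>
      ((h.measurable_sel i j).mul_const _).const_mul _)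
  have hindep : ∀ x, μ.real ({ω | ∀ i j, σ i j ω = boolSign (x i j)} ∩ T x)
      = (1 / 2) ^ (m * n) * μ.real (T x) := by
    intro x
    have h1 := h.sign_sel_indep.measure_inter_preimage_eq_mul
      {y : Fin m × Fin n → ℝ | ∀ i j, y (i, j) = boolSign (x i j)}
      {y : Fin m × Fin n → ℝ | ∀ i, |∑ j, boolSign (x i j) * (y (i, j) * z j)| < a}
      (by
        simp only [ofPred_forall]
        exact MeasurableSet.iInter fun i => MeasurableSet.iInter fun j =>
          measurableSet_eq_fun (measurable_pi_apply _) measurable_const)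
      (by
        simp only [ofPred_forall]
        refine MeasurableSet.iInter fun i => measurableSet_lt ?_ measurable_const
        exact Measurable.abs (Finset.measurable_fun_sum _ fun j _ =>
          ((measurable_pi_apply _).mul_const _).const_mul _))
    rw [← h.measure_sign_eq x, Measure.real, Measure.real, Measure.real, ← ENNReal.toReal_mul]
    exact congrArg ENNReal.toReal h1
  have hcover : {ω | ∀ i, |∑ j, σ i j ω * δ i j ω * z j| < a}
      ⊆ ⋃ x, ({ω | ∀ i j, σ i j ω = boolSign (x i j)} ∩ T x) := by
    intro ω hω
    refine mem_iUnion.2 ⟨fun i j => decide (σ i j ω = 1), ?_⟩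
    have h1 : ∀ i j, σ i j ω = boolSign (decide (σ i j ω = 1)) := by
      intro i j
      rcases h.sign_values i j ω with h | h <;> norm_num [h, boolSign]
    refine ⟨h1, fun i => ?_⟩
    have := hω i
    simp_rw [← h1, ← mul_assoc]
    exact this
  calc μ.real {ω | ∀ i, |∑ j, σ i j ω * δ i j ω * z j| < a}
      ≤ μ.real (⋃ x, ({ω | ∀ i j, σ i j ω = boolSign (x i j)} ∩ T x)) := measureReal_mono hcover
    _ ≤ ∑ x, μ.real ({ω | ∀ i j, σ i j ω = boolSign (x i j)} ∩ T x) :=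
        measureReal_iUnion_fintype_le _
    _ = ∑ x, (1 / 2) ^ (m * n) * ∫ ω, (T x).indicator 1 ω ∂μ := by
        refine Finset.sum_congr rfl fun x _ => ?_
        rw [hindep, integral_indicator_one (hTm x)]
    _ = ∫ ω, ∑ x, (1 / 2) ^ (m * n) * (T x).indicator 1 ω ∂μ := by
        rw [integral_finsetSum]
        · simp_rw [integral_const_mul]
        · intro x _
          exact (((integrable_const (1 : ℝ)).indicator (hTm x))).const_mul _
    _ ≤ ∫ ω, (1 / 2) ^ m * (((1 / 2) ^ s) ^ S.card *
          ∑ W : Finset (Fin m), ∏ j ∈ S, ∏ i ∈ Wᶜ, (1 + δ i j ω)) ∂μ := by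
        refine integral_mono ?_ ?_ fun ω => ?_
        · refine integrable_finsetSum _ fun x _ => ?_
          exact (((integrable_const (1 : ℝ)).indicator (hTm x))).const_mul _
        · refine ((integrable_finsetSum _ fun W _ => ?_).const_mul _).const_mul _
          exact h.integrable_prod_prod S _
        · have h1 := card_signs_le (fun i j => δ i j ω) (fun i j => h.sel_values i j ω) hS
          have h2 := half_pow_mul_prod_le (fun i j => δ i j ω) (fun i j => h.sel_values i j ω)
            (fun j => h.sel_card j ω) S
          have h3 : ∑ x, (1 / 2 : ℝ) ^ (m * n) * (T x).indicator 1 ω = (1 / 2) ^ (m * n) *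
              ((Finset.univ.filter fun x : Fin m → Fin n → Bool =>
                ∀ i, |∑ j, boolSign (x i j) * (δ i j ω * z j)| < a).card : ℝ) := by
            rw [← Finset.mul_sum, Finset.card_filter]
            push_cast
            congr 1
            refine Finset.sum_congr rfl fun x _ => ?_
            simp [hT, indicator_apply]
          dsimp only
          rw [h3]
          calc _ ≤ (1 / 2 : ℝ) ^ (m * n) * (2 ^ (m * n) *
                ((1 / 2) ^ m * ∏ i, (1 + ∏ j ∈ S, (1 - δ i j ω)))) := by gcongr
            _ = (1 / 2) ^ m * ∏ i, (1 + ∏ j ∈ S, (1 - δ i j ω)) := by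
                rw [← mul_assoc, ← mul_pow]; norm_num
            _ ≤ _ := by gcongr
    _ = (1 / 2) ^ m * (((1 / 2) ^ s) ^ S.card *
          ∑ W : Finset (Fin m), ∫ ω, ∏ j ∈ S, ∏ i ∈ Wᶜ, (1 + δ i j ω) ∂μ) := by
        rw [integral_const_mul, integral_const_mul, integral_finsetSum]
        exact fun W _ => h.integrable_prod_prod S _
    _ ≤ (1 / 2) ^ m * (((1 / 2) ^ s) ^ S.card *
          ∑ W : Finset (Fin m), ((1 + (s : ℝ) / m) ^ S.card) ^ (m - W.card)) := by
        gcongr with W _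
        refine (h.integral_prod_prod_le S Wᶜ).trans_eq ?_
        rw [Finset.card_compl, Fintype.card_fin]
    _ = _ := by
        have := Fin.sum_pow_mul_eq_add_pow (n := m) (1 : ℝ) ((1 + (s : ℝ) / m) ^ S.card)
        simp only [one_pow, one_mul] at this
        rw [this]

/-- The exponent is `x / 2 + x ^ 2 / 8` with `x ≤ 1`. What matters is that `5/8 < log 2`: the
difference exceeds `1/15`, the rate in the small ball estimate. -/
theorem one_add_exp_div_two_le {x : ℝ} (hx : 0 ≤ x) (hx1 : x ≤ 1) :
    (1 + Real.exp x) / 2 ≤ Real.exp (5 / 8 * x) := by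
  have h1 := Real.cosh_le_exp_half_sq (x / 2)
  have h2 : (1 + Real.exp x) / 2 = Real.exp (x / 2) * Real.cosh (x / 2) := by
    rw [Real.cosh_eq, ← mul_div_assoc, mul_add, ← Real.exp_add, ← Real.exp_add]
    simp [add_comm]
  rw [h2]
  calc _ ≤ Real.exp (x / 2) * Real.exp ((x / 2) ^ 2 / 2) := by gcongr
    _ = Real.exp (x / 2 + (x / 2) ^ 2 / 2) := by rw [Real.exp_add]
    _ ≤ _ := by
      rw [Real.exp_le_exp]
      nlinarith

/-- Small ball estimate: if `z` has `k` entries of size at least `a`, and `s k ≤ m`, then all the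
entries of the transform of `z` are smaller than `a` with probability exponentially small in
`s k`. -/
theorem IsSJLTData.measure_rows_lt_le [IsProbabilityMeasure μ]
    (h : IsSJLTData μ m n s σ δ) {z : Fin n → ℝ} {a : ℝ}
    {k : ℕ} (hm : 0 < m) (hk : k ≤ (Finset.univ.filter fun j => a ≤ |z j|).card)
    (hsk : s * k ≤ m) :
    μ.real {ω | ∀ i, |∑ j, σ i j ω * δ i j ω * z j| < a} ≤ Real.exp (-(s * k / 15)) := by
  obtain ⟨S, hS, rfl⟩ := Finset.exists_subset_card_eq hk
  refine (h.measure_rows_lt_le_aux (S := S) fun j hj => (Finset.mem_filter.1 (hS hj)).2).trans ?_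
  set k := S.card
  have hm' : (0 : ℝ) < m := by exact_mod_cast hm
  -- The expected number of elements of `S` selected by a given row.
  set x : ℝ := s * k / m with hx
  have hx0 : 0 ≤ x := by positivity
  have hx1 : x ≤ 1 := by
    rw [hx, div_le_one hm']
    exact_mod_cast hsk
  have h1 : (1 + (s : ℝ) / m) ^ k ≤ Real.exp x := by
    have := Real.add_one_le_exp ((s : ℝ) / m)
    calc (1 + (s : ℝ) / m) ^ k ≤ Real.exp ((s : ℝ) / m) ^ k := by
          gcongr
          linarith
      _ = Real.exp x := by rw [← Real.exp_nat_mul, hx]; ring_nf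
  have h2 : ((1 + (1 + (s : ℝ) / m) ^ k) / 2) ^ m ≤ Real.exp (5 / 8 * (s * k)) := by
    calc ((1 + (1 + (s : ℝ) / m) ^ k) / 2) ^ m ≤ Real.exp (5 / 8 * x) ^ m := by
          gcongr
          exact le_trans (by gcongr) (one_add_exp_div_two_le hx0 hx1)
      _ = Real.exp (5 / 8 * (s * k)) := by
          rw [← Real.exp_nat_mul, hx]
          congr 1
          field_simp
  have h3 : ((1 / 2 : ℝ) ^ s) ^ k ≤ Real.exp (-(693 / 1000 * (s * k))) := by
    have : (1 / 2 : ℝ) ≤ Real.exp (-(693 / 1000)) := by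
      rw [← Real.log_le_iff_le_exp (by norm_num), one_div, Real.log_inv]
      linarith [Real.log_two_gt_d9]
    calc ((1 / 2 : ℝ) ^ s) ^ k = (1 / 2) ^ (s * k) := by rw [pow_mul]
      _ ≤ Real.exp (-(693 / 1000)) ^ (s * k) := by gcongr
      _ = _ := by
        rw [← Real.exp_nat_mul]
        push_cast
        ring_nf
  calc (1 / 2 : ℝ) ^ m * (((1 / 2) ^ s) ^ k * (1 + (1 + (s : ℝ) / m) ^ k) ^ m)
      = ((1 / 2) ^ s) ^ k * ((1 + (1 + (s : ℝ) / m) ^ k) / 2) ^ m := by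
        rw [mul_left_comm, ← mul_pow, one_div_mul_eq_div]
    _ ≤ Real.exp (-(693 / 1000 * (s * k))) * Real.exp (5 / 8 * (s * k)) := by gcongr
    _ ≤ _ := by
        rw [← Real.exp_add, Real.exp_le_exp]
        have : (0 : ℝ) ≤ s * k := by positivity
        linarith

end SmallBall

/-! ### Choice of scale: nearly sparse or spread vectors -/

section Sparse

variable {m n : ℕ}

/-- The vectors obtained from `0` by changing at most `K` entries to elements of `V`. -/
noncomputable def sparseVecs (n : ℕ) (V : Finset ℝ) : ℕ → Finset (Fin n → ℝ)
  | 0 => {0}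
  | K + 1 => (sparseVecs n V K ×ˢ (Finset.univ ×ˢ V)).image
      fun p => Function.update p.1 p.2.1 p.2.2

theorem card_sparseVecs_le (V : Finset ℝ) (K : ℕ) :
    (sparseVecs n V K).card ≤ (n * V.card) ^ K := by
  induction K with
  | zero => simp [sparseVecs]
  | succ K ih =>
    rw [sparseVecs, pow_succ]
    refine Finset.card_image_le.trans ?_
    rw [Finset.card_product, Finset.card_product, Finset.card_univ, Fintype.card_fin]
    gcongr

theorem mem_sparseVecs (hn : 0 < n) {V : Finset ℝ} (hV : 0 ∈ V) {K : ℕ} {z : Fin n → ℝ}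
    (hz : ∀ j, z j ∈ V) (hK : (Finset.univ.filter fun j => z j ≠ 0).card ≤ K) :
    z ∈ sparseVecs n V K := by
  induction K generalizing z with
  | zero =>
    have h : z = 0 := by
      ext j
      by_contra hj
      have hm : j ∈ Finset.univ.filter fun j => z j ≠ 0 := by simpa using hj
      have := Finset.card_pos.2 ⟨j, hm⟩
      omega
    simp [sparseVecs, h]
  | succ K ih =>
    obtain ⟨j, hj⟩ : ∃ j, (Finset.univ.filter fun i => Function.update z j 0 i ≠ 0).card ≤ K := by
      by_cases h : ∃ j, z j ≠ 0
      · obtain ⟨j, hj⟩ := h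
        refine ⟨j, ?_⟩
        have h1 : (Finset.univ.filter fun i => Function.update z j 0 i ≠ 0)
            ⊆ (Finset.univ.filter fun i => z i ≠ 0).erase j := by
          intro i hi
          rcases eq_or_ne i j with rfl | hij
          · simp at hi
          · simpa [hij] using hi
        have h2 := Finset.card_le_card h1
        rw [Finset.card_erase_of_mem (by simpa using hj)] at h2
        omega
      -- The zero vector still has to use up one update; rewriting entry `0` by `0` does so, which
      -- needs `0 < n` and `0 ∈ V`.
      · push Not at h
        have h0 : z = 0 := funext h
        exact ⟨⟨0, hn⟩, by simp [h0]⟩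
    rw [sparseVecs, Finset.mem_image]
    refine ⟨(Function.update z j 0, j, z j), ?_, by simp⟩
    simp only [Finset.mem_product, Finset.mem_univ, true_and]
    refine ⟨ih (fun i => ?_) hj, hz j⟩
    rcases eq_or_ne i j with rfl | hij
    · simpa using hV
    · simpa [hij] using hz i

/-- The integers in `[-N, N]`, as real numbers. -/
noncomputable def intAlphabet (N : ℕ) : Finset ℝ :=
  (Finset.Icc (-(N : ℤ)) N).image fun k : ℤ => (k : ℝ)

theorem card_intAlphabet_le (N : ℕ) : (intAlphabet N).card ≤ 2 * N + 1 := by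
  refine Finset.card_image_le.trans ?_
  simp
  omega

theorem intCast_mem_intAlphabet {N : ℕ} {k : ℤ} (h1 : -(N : ℤ) ≤ k) (h2 : k ≤ N) :
    (k : ℝ) ∈ intAlphabet N :=
  Finset.mem_image.2 ⟨k, Finset.mem_Icc.2 ⟨h1, h2⟩, rfl⟩

/-- Doubling at every one of the `p` steps would give `k p ≥ 2 ^ p > N`. -/
theorem exists_lt_two_mul_of_lt_two_pow {k : ℕ → ℕ} {N p : ℕ} (h0 : 1 ≤ k 0) (hN : k p ≤ N)
    (hp : N < 2 ^ p) : ∃ l < p, k (l + 1) < 2 * k l := by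
  by_contra! h
  have : ∀ l ≤ p, 2 ^ l ≤ k l := by
    intro l
    induction l with
    | zero => simpa using h0
    | succ l ih =>
      intro hl
      have := ih (by omega)
      have := h l (by omega)
      rw [pow_succ]
      omega
  have := this p le_rfl
  omega

theorem abs_sum_mul_le {w y : Fin n → ℝ} (hw : ∀ j, |w j| ≤ 1) {b : ℝ} (hy : ∀ j, |y j| ≤ b) :
    |∑ j, w j * y j| ≤ n * b := by
  calc |∑ j, w j * y j| ≤ ∑ j, |w j * y j| := Finset.abs_sum_le_sum_abs _ _
    _ ≤ ∑ _j : Fin n, b := by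
      refine Finset.sum_le_sum fun j _ => ?_
      rw [abs_mul]
      nlinarith [abs_nonneg (w j), abs_nonneg (y j), hw j, hy j]
    _ = n * b := by simp

theorem abs_sum_mul_sub_le {w y y' : Fin n → ℝ} (hw : ∀ j, |w j| ≤ 1) {b : ℝ}
    (hy : ∀ j, |y j - y' j| ≤ b) : |∑ j, w j * y' j| ≤ |∑ j, w j * y j| + n * b := by
  have h1 := abs_sum_mul_le hw (y := fun j => y j - y' j) hy
  simp only [mul_sub, Finset.sum_sub_distrib] at h1
  have h2 := abs_sub_abs_le_abs_sub (∑ j, w j * y' j) (∑ j, w j * y j)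
  rw [abs_sub_comm] at h2
  linarith

/-- A matrix which is bounded below on sparse integer vectors and on the spread vector `y` is
bounded below at `y`, whatever `y`: at some scale `Q ^ (-l)` the number of large entries
of `y` less than doubles, and then `y` is close to a sparse vector, or spread. -/
theorem exists_row_ge (hn : 0 < n) {M : Fin m → Fin n → ℝ} (hM : ∀ i j, |M i j| ≤ 1)
    {s p Q : ℕ} (hp : n < 2 ^ p) (hQ : Q = 4 * n)
    (hA : ∀ k : ℕ, 1 ≤ k → k ≤ n → s * k ≤ m → ∀ z ∈ sparseVecs n (intAlphabet (Q ^ p)) (2 * k),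
      k ≤ (Finset.univ.filter fun j => (Q : ℝ) - 1 ≤ |z j|).card →
        ∃ i, (Q : ℝ) - 1 ≤ |∑ j, M i j * z j|)
    {y : Fin n → ℝ} (hy : y ≠ 0) {b : ℝ} (hb : b ≤ ‖y‖)
    (hB : m / s ≤ (Finset.univ.filter fun j => ‖y‖ / Q ^ p ≤ |y j|).card →
      ∃ i, b / (4 * Q ^ p) ≤ |∑ j, M i j * y j|) :
    ∃ i, b / (4 * Q ^ p) ≤ |∑ j, M i j * y j| := by
  classical
  have hy0 : 0 < ‖y‖ := norm_pos_iff.2 hy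
  have hn1 : (1 : ℝ) ≤ n := by exact_mod_cast hn
  have hQr : (Q : ℝ) = 4 * n := by rw [hQ]; push_cast; ring
  have hQ1 : (1 : ℝ) ≤ Q := by linarith
  have hQ0 : (0 : ℝ) < Q := by linarith
  set S : ℕ → Finset (Fin n) := fun l => Finset.univ.filter fun j => ‖y‖ / Q ^ l ≤ |y j| with hS
  have hSmono : ∀ l l', l ≤ l' → S l ⊆ S l' := by
    intro l l' hl j hj
    rw [hS, Finset.mem_filter] at hj ⊢
    refine ⟨hj.1, le_trans ?_ hj.2⟩
    gcongr
  have h0 : 1 ≤ (S 0).card := by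
    rw [Nat.one_le_iff_ne_zero, ← Nat.pos_iff_ne_zero, Finset.card_pos]
    by_contra hne
    rw [Finset.not_nonempty_iff_eq_empty] at hne
    have : ‖y‖ < ‖y‖ := by
      rw [pi_norm_lt_iff hy0]
      intro j
      by_contra! hj
      have : j ∈ S 0 := by simpa [hS] using hj
      simp [hne] at this
    exact lt_irrefl _ this
  have hcard : ∀ l, (S l).card ≤ n := fun l => by simpa using Finset.card_le_univ (S l)
  obtain ⟨l, hl, hlt⟩ := exists_lt_two_mul_of_lt_two_pow (k := fun l => (S l).card) h0 (hcard p) hp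
  by_cases hsm : s * (S l).card ≤ m
  swap
  -- Spread case: more than `m / s` entries are above the `l`-th threshold, hence above the last
  -- one.
  · refine hB (le_trans ?_ (Finset.card_le_card (hSmono l p hl.le)))
    rw [not_le, mul_comm] at hsm
    exact (Nat.div_lt_of_lt_mul (by rwa [mul_comm])).le
  -- In this scaling the entries in `S l` have size at least `Q` and those outside `S (l + 1)` less
  -- than `1`; rounding the former scale's survivors and dropping the rest costs at most `1` per
  -- entry.
  set x : Fin n → ℝ := fun j => Q ^ (l + 1) / ‖y‖ * y j with hx
  set z : Fin n → ℝ := fun j => if j ∈ S (l + 1) then (⌊x j⌋ : ℝ) else 0 with hz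
  have hcoef : (0 : ℝ) < Q ^ (l + 1) / ‖y‖ := by positivity
  have habs : ∀ j, |x j| = Q ^ (l + 1) / ‖y‖ * |y j| := fun j => by
    rw [hx]; dsimp only; rw [abs_mul, abs_of_pos hcoef]
  have hxle : ∀ j, |x j| ≤ Q ^ p := by
    intro j
    rw [habs]
    calc (Q : ℝ) ^ (l + 1) / ‖y‖ * |y j| ≤ Q ^ (l + 1) / ‖y‖ * ‖y‖ := by
          gcongr
          exact norm_le_pi_norm y j
      _ = Q ^ (l + 1) := by field_simp
      _ ≤ Q ^ p := pow_le_pow_right₀ hQ1 hl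
  have hxz : ∀ j, |x j - z j| ≤ 1 := by
    intro j
    rw [hz]; dsimp only
    split_ifs with hj
    · rw [abs_le]
      constructor <;> linarith [Int.floor_le (x j), Int.lt_floor_add_one (x j)]
    · rw [sub_zero, habs]
      have : |y j| < ‖y‖ / Q ^ (l + 1) := by simpa [hS] using hj
      calc (Q : ℝ) ^ (l + 1) / ‖y‖ * |y j| ≤ Q ^ (l + 1) / ‖y‖ * (‖y‖ / Q ^ (l + 1)) := by gcongr
        _ = 1 := by field_simp
  have hmem : z ∈ sparseVecs n (intAlphabet (Q ^ p)) (2 * (S l).card) := by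
    refine mem_sparseVecs hn ?_ (fun j => ?_) ?_
    · exact_mod_cast intCast_mem_intAlphabet (N := Q ^ p) (k := 0) (by simp) (by positivity)
    · rw [hz]; dsimp only
      have hj := abs_le.1 (hxle j)
      split_ifs
      · refine intCast_mem_intAlphabet (Int.le_floor.2 (by push_cast; exact hj.1)) ?_
        have := (Int.floor_le (x j)).trans hj.2
        exact_mod_cast this
      · exact_mod_cast intCast_mem_intAlphabet (N := Q ^ p) (k := 0) (by simp) (by positivity)
    · refine le_trans (Finset.card_le_card fun j hj => ?_) hlt.le
      by_contra hj'
      simp [hz, hj'] at hj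
  obtain ⟨i, hi⟩ := hA _ (h0.trans (Finset.card_le_card (hSmono 0 l (Nat.zero_le _)))) (hcard l)
    hsm z hmem (Finset.card_le_card fun j hj => by
      have hj1 := hSmono l (l + 1) (Nat.le_succ l) hj
      simp only [Finset.mem_filter, Finset.mem_univ, true_and]
      have h1 : (Q : ℝ) ≤ |x j| := by
        rw [habs]
        have : ‖y‖ / Q ^ l ≤ |y j| := by simpa [hS] using hj
        calc (Q : ℝ) = Q ^ (l + 1) / ‖y‖ * (‖y‖ / Q ^ l) := by
              rw [pow_succ]; field_simp
          _ ≤ _ := by gcongr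
      have h2 := hxz j
      have h3 := abs_sub_abs_le_abs_sub (x j) (z j)
      linarith)
  refine ⟨i, ?_⟩
  have h1 := abs_sum_mul_sub_le (hM i) hxz
  have h2 : ∑ j, M i j * x j = Q ^ (l + 1) / ‖y‖ * ∑ j, M i j * y j := by
    rw [Finset.mul_sum]
    exact Finset.sum_congr rfl fun j _ => by rw [hx]; ring
  rw [h2, abs_mul, abs_of_pos hcoef] at h1
  -- Rounding changes a row sum by at most `n`, and `Q - 1 - n ≥ 1` because `Q = 4 n`.
  have h3 : (1 : ℝ) ≤ Q ^ (l + 1) / ‖y‖ * |∑ j, M i j * y j| := by linarith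
  have h4 : (Q : ℝ) ^ (l + 1) ≤ Q ^ p := pow_le_pow_right₀ hQ1 hl
  rw [div_mul_eq_mul_div, le_div_iff₀ hy0, one_mul] at h3
  rw [div_le_iff₀ (by positivity)]
  nlinarith [abs_nonneg (∑ j, M i j * y j)]

end Sparse

/-! ### Nets of the ball, of the secants and of the tangent vectors -/

section Nets

/-- The factor `n` in place of `√n` is harmless: polynomial losses enter only through their
logarithm. -/
theorem EuclideanSpace.norm_le_of_forall_abs_le {n : ℕ} {y : EuclideanSpace ℝ (Fin n)} {b : ℝ}
    (hb : 0 ≤ b) (h : ∀ j, |y j| ≤ b) : ‖y‖ ≤ n * b := by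
  refine abs_le_of_sq_le_sq' ?_ (by positivity) |>.2
  rw [EuclideanSpace.norm_sq_eq]
  calc ∑ j, ‖y j‖ ^ 2 ≤ ∑ _j : Fin n, b ^ 2 :=
        Finset.sum_le_sum fun j _ => pow_le_pow_left₀ (norm_nonneg _) (h j) 2
    _ = n * b ^ 2 := by simp
    _ ≤ n ^ 2 * b ^ 2 := by
        gcongr
        exact_mod_cast Nat.le_self_pow two_ne_zero n
    _ = (n * b) ^ 2 := by ring

theorem norm_le_mul_norm_ofLp {n : ℕ} (y : EuclideanSpace ℝ (Fin n)) :
    ‖y‖ ≤ n * ‖y.ofLp‖ :=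
  EuclideanSpace.norm_le_of_forall_abs_le (norm_nonneg _) fun j => norm_le_pi_norm y.ofLp j

/-- A net of the unit ball, obtained from a grid. -/
theorem exists_net_unitBall (d : ℕ) {M : ℕ} (hM : 0 < M) :
    ∃ N : Finset (EuclideanSpace ℝ (Fin d)), N.card ≤ (2 * M + 1) ^ d ∧
      (∀ u ∈ N, u ∈ unitBall d) ∧ ∀ u ∈ unitBall d, ∃ u' ∈ N, ‖u - u'‖ ≤ d / M := by
  classical
  have hM' : (0 : ℝ) < M := by exact_mod_cast hM
  let cell : EuclideanSpace ℝ (Fin d) → Fin d → ℤ := fun u j => ⌊M * u j⌋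
  let P : Finset (Fin d → ℤ) := Fintype.piFinset fun _ => Finset.Icc (-(M : ℤ)) M
  have hcell : ∀ u ∈ unitBall d, cell u ∈ P := by
    intro u hu
    refine Fintype.mem_piFinset.2 fun j => Finset.mem_Icc.2 ?_
    have h1 : |u j| ≤ 1 := (PiLp.norm_apply_le u j).trans (by simpa [unitBall] using hu)
    rw [abs_le] at h1
    refine ⟨Int.le_floor.2 ?_, ?_⟩
    · push_cast
      nlinarith
    · have h2 : ((⌊M * u j⌋ : ℤ) : ℝ) ≤ M := (Int.floor_le _).trans (by nlinarith)
      exact_mod_cast h2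
  -- Representatives are taken inside the ball, where `F` is controlled, rather than at grid points;
  -- cells that miss the ball get the dummy value `0`.
  let rep : (Fin d → ℤ) → EuclideanSpace ℝ (Fin d) := fun c =>
    if h : ∃ u ∈ unitBall d, cell u = c then h.choose else 0
  have hrep : ∀ c, rep c ∈ unitBall d := by
    intro c
    by_cases h : ∃ u ∈ unitBall d, cell u = c
    · simp only [rep, dif_pos h]; exact h.choose_spec.1
    · simp only [rep, dif_neg h]; simp [unitBall]
  have hrep' : ∀ u ∈ unitBall d, cell (rep (cell u)) = cell u := by
    intro u hu
    have h : ∃ v ∈ unitBall d, cell v = cell u := ⟨u, hu, rfl⟩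
    simp only [rep, dif_pos h]; exact h.choose_spec.2
  refine ⟨P.image rep, Finset.card_image_le.trans ?_, ?_, fun u hu =>
    ⟨rep (cell u), Finset.mem_image_of_mem _ (hcell u hu), ?_⟩⟩
  · simp only [P, Fintype.card_piFinset, Int.card_Icc, Finset.prod_const, Finset.card_univ,
      Fintype.card_fin]
    gcongr
    omega
  · intro u hu
    obtain ⟨c, -, rfl⟩ := Finset.mem_image.1 hu
    exact hrep c
  · rw [div_eq_mul_one_div]
    refine EuclideanSpace.norm_le_of_forall_abs_le (by positivity) fun j => ?_
    have h1 : ⌊M * rep (cell u) j⌋ = ⌊M * u j⌋ := congrFun (hrep' u hu) j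
    have h2 := Int.abs_sub_lt_one_of_floor_eq_floor h1.symm
    rw [← mul_sub, abs_mul, abs_of_pos hM'] at h2
    rw [le_div_iff₀ hM', mul_comm]
    exact h2.le

variable {d n : ℕ} {κ : ℝ} {F : EuclideanSpace ℝ (Fin d) → EuclideanSpace ℝ (Fin n)}

/-- The derivative at the centre is injective. This lets the mesh of the nets be chosen in terms of
`n` and `κ` alone. -/
theorem IsBiLipschitzParam.dim_le (hF : IsBiLipschitzParam κ F) (hκ : 0 < κ) : d ≤ n := by
  have h0 : (0 : EuclideanSpace ℝ (Fin d)) ∈ unitBall d := by simp [unitBall]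
  have hinj : Function.Injective (ballDeriv F 0).toLinearMap := by
    refine (injective_iff_map_eq_zero _).2 fun θ h => ?_
    have := hF.le_norm_ballDeriv hκ.le h0 θ
    simp only [ContinuousLinearMap.coe_coe] at h
    rw [h, norm_zero] at this
    have hk := inv_pos.2 hκ
    exact norm_eq_zero.1 (le_antisymm (by nlinarith [norm_nonneg θ]) (norm_nonneg θ))
  simpa using LinearMap.finrank_le_finrank_of_injective hinj

theorem card_image₂_le {α β : Type*} [DecidableEq β] (N : Finset α) (g : α → α → β) :
    (Finset.image₂ g N N).card ≤ N.card ^ 2 := by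
  rw [pow_two]
  exact Finset.card_image₂_le _ _ _

/-- A finite set approximating the differences of points of `F (unitBall d)`. -/
theorem IsBiLipschitzParam.exists_secant_net (hF : IsBiLipschitzParam κ F) (hκ : 0 ≤ κ) {M : ℕ}
    (hM : 0 < M) :
    ∃ Y : Finset (Fin n → ℝ), Y.card ≤ (2 * M + 1) ^ (2 * d) ∧
      ∀ u ∈ unitBall d, ∀ w ∈ unitBall d, ∃ y ∈ Y, ∀ j,
        |(F u - F w) j - y j| ≤ 2 * κ * (d / M) := by
  classical
  obtain ⟨N, hN, hNB, hnet⟩ := exists_net_unitBall d hM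
  refine ⟨Finset.image₂ (fun u w => (F u - F w).ofLp) N N, (card_image₂_le _ _).trans ?_, ?_⟩
  · rw [mul_comm 2 d, pow_mul]
    gcongr
  · intro u hu w hw
    obtain ⟨u', hu', huu⟩ := hnet u hu
    obtain ⟨w', hw', hww⟩ := hnet w hw
    refine ⟨_, Finset.mem_image₂_of_mem hu' hw', fun j => ?_⟩
    refine (PiLp.norm_apply_le (F u - F w - (F u' - F w')) j).trans ?_
    have h1 : F u - F w - (F u' - F w') = (F u - F u') - (F w - F w') := by abel
    rw [h1]
    have h2 := hF.dist_le u hu u' (hNB u' hu')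
    have h3 := hF.dist_le w hw w' (hNB w' hw')
    have h4 := norm_sub_le (F u - F u') (F w - F w')
    nlinarith

/-- A finite set approximating the tangent vectors of `F (unitBall d)`. -/
theorem IsBiLipschitzParam.exists_tangent_net (hF : IsBiLipschitzParam κ F) (hκ : 0 ≤ κ) {M : ℕ}
    (hM : 0 < M) :
    ∃ Y : Finset (Fin n → ℝ), Y.card ≤ (2 * M + 1) ^ (2 * d) ∧
      ∀ w ∈ unitBall d, ∀ θ ∈ unitBall d, ∃ y ∈ Y, ∀ j,
        |ballDeriv F w θ j - y j| ≤ 2 * κ * (d / M) := by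
  classical
  obtain ⟨N, hN, hNB, hnet⟩ := exists_net_unitBall d hM
  refine ⟨Finset.image₂ (fun w θ => (ballDeriv F w θ).ofLp) N N, (card_image₂_le _ _).trans ?_, ?_⟩
  · rw [mul_comm 2 d, pow_mul]
    gcongr
  · intro w hw θ hθ
    obtain ⟨w', hw', hww⟩ := hnet w hw
    obtain ⟨θ', hθ', hθθ⟩ := hnet θ hθ
    refine ⟨_, Finset.mem_image₂_of_mem hw' hθ', fun j => ?_⟩
    refine (PiLp.norm_apply_le (ballDeriv F w θ - ballDeriv F w' θ') j).trans ?_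
    have h1 : ballDeriv F w θ - ballDeriv F w' θ'
        = (ballDeriv F w - ballDeriv F w') θ + ballDeriv F w' (θ - θ') := by
      rw [_root_.sub_apply, map_sub]; abel
    rw [h1]
    have hθ1 : ‖θ‖ ≤ 1 := by simpa [unitBall] using hθ
    have h2 := (ballDeriv F w - ballDeriv F w').le_opNorm θ
    have h3 := hF.deriv_lipschitz w hw w' (hNB w' hw')
    have h4 := hF.norm_ballDeriv_le hκ (hNB w' hw') (θ - θ')
    have h5 := norm_add_le ((ballDeriv F w - ballDeriv F w') θ) (ballDeriv F w' (θ - θ'))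
    have h6 : ‖ballDeriv F w - ballDeriv F w'‖ * ‖θ‖ ≤ ‖ballDeriv F w - ballDeriv F w'‖ * 1 := by
      gcongr
    nlinarith

end Nets

theorem abs_sum_div_sqrt_le_norm_sjlt {Ω : Type*} {m n s : ℕ} {σ δ : Fin m → Fin n → Ω → ℝ}
    (hs : 0 < s) (ω : Ω) (y : EuclideanSpace ℝ (Fin n)) (i : Fin m) :
    |∑ j, σ i j ω * δ i j ω * y j| / √s ≤ ‖sjlt s σ δ ω y‖ := by
  refine le_trans (le_of_eq ?_) (PiLp.norm_apply_le _ i)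
  have h1 : (sjlt s σ δ ω y) i = 1 / √s * ∑ j, σ i j ω * δ i j ω * y j := by
    simp only [sjlt, sjltMatrix, Matrix.toLpLin_apply, Matrix.mulVec, dotProduct, Matrix.of_apply,
      Finset.mul_sum]
    exact Finset.sum_congr rfl fun j _ => by ring
  rw [h1, Real.norm_eq_abs, abs_mul, abs_of_nonneg (show 0 ≤ 1 / √(s : ℝ) by positivity)]
  ring

/-! ### Exceptional sets from union bounds -/

section Event

variable {Ω : Type*} [MeasurableSpace Ω] {μ : Measure Ω} {m n s : ℕ}
  {σ δ : Fin m → Fin n → Ω → ℝ}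

/-- Union bound over finitely many vectors with `k` entries of size at least `a`. -/
theorem IsSJLTData.exists_exceptional_set [IsProbabilityMeasure μ] (h : IsSJLTData μ m n s σ δ)
    (hm : 0 < m) {k : ℕ} (hsk : s * k ≤ m) (a : ℝ) (Y : Finset (Fin n → ℝ)) :
    ∃ Z : Set Ω, μ.real Z ≤ Y.card * Real.exp (-(s * k / 15)) ∧ ∀ ω ∉ Z, ∀ z ∈ Y,
      k ≤ (Finset.univ.filter fun j => a ≤ |z j|).card →
        ∃ i, a ≤ |∑ j, σ i j ω * δ i j ω * z j| := by
  classical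
  refine ⟨⋃ z ∈ Y.filter fun z => k ≤ (Finset.univ.filter fun j => a ≤ |z j|).card,
    {ω | ∀ i, |∑ j, σ i j ω * δ i j ω * z j| < a}, ?_, fun ω hω z hz hk => ?_⟩
  · refine (measureReal_biUnion_finset_le _ _).trans ?_
    refine (Finset.sum_le_card_nsmul _ _ _ fun z hz =>
      h.measure_rows_lt_le hm (Finset.mem_filter.1 hz).2 hsk).trans ?_
    rw [nsmul_eq_mul]
    gcongr
    exact Finset.filter_subset _ _
  · by_contra! hlt
    exact hω (mem_iUnion₂.2 ⟨z, Finset.mem_filter.2 ⟨hz, hk⟩, hlt⟩)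

/-- There are at most `exp (s k / 30)` vectors with `2k` nonzero entries, half the exponent of the
small ball bound, so each `k` leaves `exp (-s k / 30) ≤ exp (-s / 30)`; the factor `n` sums over
`k`. -/
theorem IsSJLTData.exists_sparse_exceptional_set [IsProbabilityMeasure μ]
    (h : IsSJLTData μ m n s σ δ) (hm : 0 < m) (a : ℝ) {N : ℕ}
    (hN : (n : ℝ) * (2 * N + 1) ≤ Real.exp (s / 60)) :
    ∃ Z : Set Ω, μ.real Z ≤ n * Real.exp (-(s / 30)) ∧ ∀ ω ∉ Z, ∀ k : ℕ, 1 ≤ k → k ≤ n →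
      s * k ≤ m → ∀ z ∈ sparseVecs n (intAlphabet N) (2 * k),
        k ≤ (Finset.univ.filter fun j => a ≤ |z j|).card →
          ∃ i, a ≤ |∑ j, σ i j ω * δ i j ω * z j| := by
  classical
  have hex : ∀ k : ℕ, ∃ Z : Set Ω, s * k ≤ m →
      (μ.real Z ≤ (sparseVecs n (intAlphabet N) (2 * k)).card * Real.exp (-(s * k / 15)) ∧
      ∀ ω ∉ Z, ∀ z ∈ sparseVecs n (intAlphabet N) (2 * k),
        k ≤ (Finset.univ.filter fun j => a ≤ |z j|).card →
          ∃ i, a ≤ |∑ j, σ i j ω * δ i j ω * z j|) := by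
    intro k
    by_cases hsk : s * k ≤ m
    · obtain ⟨Z, hZ⟩ := h.exists_exceptional_set hm hsk a (sparseVecs n (intAlphabet N) (2 * k))
      exact ⟨Z, fun _ => hZ⟩
    · exact ⟨∅, fun h => absurd h hsk⟩
  choose Z hZ using hex
  refine ⟨⋃ k ∈ (Finset.Icc 1 n).filter fun k => s * k ≤ m, Z k, ?_, fun ω hω k hk1 hkn hsk => ?_⟩
  · refine (measureReal_biUnion_finset_le _ _).trans ?_
    have hterm : ∀ k ∈ (Finset.Icc 1 n).filter fun k => s * k ≤ m,
        μ.real (Z k) ≤ Real.exp (-(s / 30)) := by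
      intro k hk
      obtain ⟨hk, hsk⟩ := Finset.mem_filter.1 hk
      have hk1 : (1 : ℝ) ≤ k := by exact_mod_cast (Finset.mem_Icc.1 hk).1
      have hc : ((sparseVecs n (intAlphabet N) (2 * k)).card : ℝ) ≤ Real.exp (s * k / 30) := by
        calc ((sparseVecs n (intAlphabet N) (2 * k)).card : ℝ)
            ≤ ((n * (intAlphabet N).card) ^ (2 * k) : ℕ) := by
              exact_mod_cast card_sparseVecs_le _ _
          _ ≤ ((n * (2 * N + 1)) ^ (2 * k) : ℕ) := by
              have := card_intAlphabet_le N
              gcongr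
          _ = ((n : ℝ) * (2 * N + 1)) ^ (2 * k) := by push_cast; rfl
          _ ≤ Real.exp (s / 60) ^ (2 * k) := by gcongr
          _ = Real.exp (s * k / 30) := by
              rw [← Real.exp_nat_mul]; push_cast; congr 1; ring
      calc μ.real (Z k) ≤ _ := (hZ k hsk).1
        _ ≤ Real.exp (s * k / 30) * Real.exp (-(s * k / 15)) := by gcongr
        _ ≤ Real.exp (-(s / 30)) := by
            rw [← Real.exp_add, Real.exp_le_exp]
            have : (s : ℝ) ≤ s * k := le_mul_of_one_le_right (by positivity) hk1
            linarith
    refine (Finset.sum_le_card_nsmul _ _ _ hterm).trans ?_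
    rw [nsmul_eq_mul]
    gcongr
    simpa using Finset.card_filter_le (Finset.Icc 1 n) fun k => s * k ≤ m
  · refine (hZ k hsk).2 ω fun hmem => hω ?_
    exact mem_iUnion₂.2 ⟨k, Finset.mem_filter.2 ⟨Finset.mem_Icc.2 ⟨hk1, hkn⟩, hsk⟩, hmem⟩

theorem IsSJLTData.sparsity_le [IsProbabilityMeasure μ] (h : IsSJLTData μ m n s σ δ)
    (hn : 0 < n) : s ≤ m := by
  obtain ⟨ω⟩ : Nonempty Ω := nonempty_of_isProbabilityMeasure μ
  have h1 := h.sel_card ⟨0, hn⟩ ω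
  have h2 : ∑ i : Fin m, δ i ⟨0, hn⟩ ω ≤ ∑ _i : Fin m, (1 : ℝ) :=
    Finset.sum_le_sum fun i _ => by
      rcases h.sel_values i ⟨0, hn⟩ ω with h | h <;> simp [h]
  rw [h1] at h2
  simpa using h2

theorem IsSJLTData.abs_entry_le (h : IsSJLTData μ m n s σ δ) (ω : Ω) (i : Fin m) (j : Fin n) :
    |σ i j ω * δ i j ω| ≤ 1 := by
  rcases h.sign_values i j ω with h1 | h1 <;> rcases h.sel_values i j ω with h2 | h2 <;>
    simp [h1, h2]

end Event

/-! ### Lower bound on all secants -/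

section LowerBound

variable {d m n : ℕ} {κ : ℝ} {F : EuclideanSpace ℝ (Fin d) → EuclideanSpace ℝ (Fin n)}

/-- A matrix which is bounded below on sparse integer vectors and on the spread elements of a
finite set is bounded below near that set. -/
theorem exists_row_ge_of_net (hn : 0 < n) {M : Fin m → Fin n → ℝ} (hM : ∀ i j, |M i j| ≤ 1)
    {s p Q : ℕ} (hp : n < 2 ^ p) (hQ : Q = 4 * n)
    (hA : ∀ k : ℕ, 1 ≤ k → k ≤ n → s * k ≤ m → ∀ z ∈ sparseVecs n (intAlphabet (Q ^ p)) (2 * k),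
      k ≤ (Finset.univ.filter fun j => (Q : ℝ) - 1 ≤ |z j|).card →
        ∃ i, (Q : ℝ) - 1 ≤ |∑ j, M i j * z j|)
    {b : ℝ} (hb : 0 < b) {Y : Finset (Fin n → ℝ)}
    (hB : ∀ z ∈ Y, m / s ≤ (Finset.univ.filter fun j => b / (2 * (Q : ℝ) ^ p) ≤ |z j|).card →
      ∃ i, b / (2 * (Q : ℝ) ^ p) ≤ |∑ j, M i j * z j|)
    {y : EuclideanSpace ℝ (Fin n)} (hby : n * b ≤ ‖y‖)
    (hY : ∃ z ∈ Y, ∀ j, |y j - z j| ≤ b / (4 * n * (Q : ℝ) ^ p)) :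
    ∃ i, b / (4 * (Q : ℝ) ^ p) ≤ |∑ j, M i j * y j| := by
  have hn1 : (1 : ℝ) ≤ n := by exact_mod_cast hn
  have hQ0 : (0 : ℝ) < Q := by rw [hQ]; push_cast; linarith
  have hby' : b ≤ ‖y.ofLp‖ := by
    have := hby.trans (norm_le_mul_norm_ofLp y)
    exact le_of_mul_le_mul_left this (by linarith)
  have hy0 : y.ofLp ≠ 0 := norm_pos_iff.1 (hb.trans_le hby')
  obtain ⟨z, hz, hzy⟩ := hY
  have hη : b / (4 * n * (Q : ℝ) ^ p) ≤ b / (2 * (Q : ℝ) ^ p) := by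
    gcongr
    linarith
  refine exists_row_ge hn hM hp hQ hA hy0 hby' fun hspread => ?_
  obtain ⟨i, hi⟩ := hB z hz (hspread.trans (Finset.card_le_card fun j hj => by
    simp only [Finset.mem_filter, Finset.mem_univ, true_and] at hj ⊢
    have h1 : b / (Q : ℝ) ^ p ≤ ‖y.ofLp‖ / (Q : ℝ) ^ p := by gcongr
    have h2 := abs_sub_abs_le_abs_sub (y j) (z j)
    have h3 := hzy j
    have h4 : b / (Q : ℝ) ^ p = b / (2 * (Q : ℝ) ^ p) + b / (2 * (Q : ℝ) ^ p) := by
      field_simp; norm_num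
    linarith))
  refine ⟨i, ?_⟩
  have h1 := abs_sum_mul_sub_le (hM i) hzy
  -- The net error in a row sum is half of the lower bound at the net point.
  have h2 : n * (b / (4 * n * (Q : ℝ) ^ p)) = b / (4 * (Q : ℝ) ^ p) := by field_simp
  have h3 : b / (2 * (Q : ℝ) ^ p) = b / (4 * (Q : ℝ) ^ p) + b / (4 * (Q : ℝ) ^ p) := by
    field_simp; norm_num
  linarith

/-- A matrix which is bounded below on sparse integer vectors and on the spread elements of nets of
the secants and of the tangents is bounded below on the differences of points of
`F (unitBall d)`. -/
theorem IsBiLipschitzParam.exists_row_ge_secant (hF : IsBiLipschitzParam κ F) (hκ : 1 ≤ κ)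
    (hn : 0 < n) {M : Fin m → Fin n → ℝ} (hM : ∀ i j, |M i j| ≤ 1)
    {s p Q : ℕ} (hp : n < 2 ^ p) (hQ : Q = 4 * n)
    (hA : ∀ k : ℕ, 1 ≤ k → k ≤ n → s * k ≤ m → ∀ z ∈ sparseVecs n (intAlphabet (Q ^ p)) (2 * k),
      k ≤ (Finset.univ.filter fun j => (Q : ℝ) - 1 ≤ |z j|).card →
        ∃ i, (Q : ℝ) - 1 ≤ |∑ j, M i j * z j|)
    {b₀ b₁ h : ℝ} (hb₁ : b₁ = 1 / (κ * n))
    (hb₀ : b₀ = 1 / (8 * κ ^ 3 * n ^ 3 * (Q : ℝ) ^ p))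
    (hh : h ≤ 1 / (32 * κ ^ 3 * n ^ 4 * ((Q : ℝ) ^ p) ^ 2))
    {Y₀ Y₁ : Finset (Fin n → ℝ)}
    (hB₀ : ∀ z ∈ Y₀, m / s ≤ (Finset.univ.filter fun j => b₀ / (2 * (Q : ℝ) ^ p) ≤ |z j|).card →
      ∃ i, b₀ / (2 * (Q : ℝ) ^ p) ≤ |∑ j, M i j * z j|)
    (hB₁ : ∀ z ∈ Y₁, m / s ≤ (Finset.univ.filter fun j => b₁ / (2 * (Q : ℝ) ^ p) ≤ |z j|).card →
      ∃ i, b₁ / (2 * (Q : ℝ) ^ p) ≤ |∑ j, M i j * z j|)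
    (hY₀ : ∀ u ∈ unitBall d, ∀ w ∈ unitBall d, ∃ y ∈ Y₀, ∀ j, |(F u - F w) j - y j| ≤ h)
    (hY₁ : ∀ w ∈ unitBall d, ∀ θ ∈ unitBall d, ∃ y ∈ Y₁, ∀ j, |ballDeriv F w θ j - y j| ≤ h) :
    ∃ c : ℝ, 0 < c ∧ ∀ u ∈ unitBall d, ∀ w ∈ unitBall d, u ≠ w →
      ∃ i, c * ‖u - w‖ ≤ |∑ j, M i j * (F u - F w) j| := by
  have hn1 : (1 : ℝ) ≤ n := by exact_mod_cast hn
  have hκ0 : 0 < κ := by linarith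
  have hQ1 : (1 : ℝ) ≤ Q := by rw [hQ]; push_cast; linarith
  set D : ℝ := (Q : ℝ) ^ p with hD
  have hD1 : 1 ≤ D := one_le_pow₀ hQ1
  have hb₁0 : 0 < b₁ := by rw [hb₁]; positivity
  have hb₀0 : 0 < b₀ := by rw [hb₀]; positivity
  have hh₀ : h ≤ b₀ / (4 * n * D) := by
    refine hh.trans_eq ?_
    rw [hb₀]
    field_simp
    norm_num
  have hh₁ : h ≤ b₁ / (4 * n * D) := by
    refine hh₀.trans ?_
    gcongr
    rw [hb₀, hb₁]
    have h1 : κ ≤ κ ^ 3 := le_self_pow₀ hκ (by norm_num)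
    have h2 : (n : ℝ) ≤ n ^ 3 := le_self_pow₀ hn1 (by norm_num)
    have h3 : κ * n ≤ κ ^ 3 * n ^ 3 := by gcongr
    refine one_div_le_one_div_of_le (by positivity) ?_
    have h4 : κ ^ 3 * n ^ 3 * 1 ≤ κ ^ 3 * n ^ 3 * D := by gcongr
    have h5 : 0 ≤ κ ^ 3 * (n : ℝ) ^ 3 := by positivity
    nlinarith
  -- Threshold between short and long secants. It is chosen so that the Taylor error of a row sum,
  -- `n κ r ‖u - w‖`, is half of the bound `g ‖u - w‖` from the tangent vector; `b₀` is then fixed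
  -- by `n b₀ = r / κ`.
  set r : ℝ := 1 / (8 * κ ^ 2 * n ^ 2 * D) with hr
  have hr0 : 0 < r := by positivity
  set g : ℝ := b₁ / (4 * D) with hg
  have hg0 : 0 < g := by positivity
  have hgr : n * (κ * r) = g / 2 := by
    rw [hr, hg, hb₁]
    field_simp
    norm_num
  refine ⟨min (g / 2) (b₀ / (8 * D)), lt_min (by positivity) (by positivity),
    fun u hu w hw huw => ?_⟩
  have huw0 : 0 < ‖u - w‖ := norm_pos_iff.2 (sub_ne_zero.2 huw)
  rcases le_total ‖u - w‖ r with hle | hge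
  · set θ : EuclideanSpace ℝ (Fin d) := ‖u - w‖⁻¹ • (u - w) with hθ
    have hθ1 : ‖θ‖ = 1 := by
      rw [hθ, norm_smul, norm_inv, norm_norm, inv_mul_cancel₀ huw0.ne']
    have hθB : θ ∈ unitBall d := by simp [unitBall, hθ1]
    have hy : n * b₁ ≤ ‖ballDeriv F w θ‖ := by
      have h1 := hF.le_norm_ballDeriv hκ0.le hw θ
      rw [hθ1, mul_one] at h1
      refine le_trans (le_of_eq ?_) h1
      rw [hb₁]; field_simp
    obtain ⟨z, hz, hzh⟩ := hY₁ w hw θ hθB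
    obtain ⟨i, hi⟩ := exists_row_ge_of_net hn hM hp hQ hA hb₁0 hB₁ hy
      ⟨z, hz, fun j => (hzh j).trans hh₁⟩
    refine ⟨i, ?_⟩
    have htaylor := norm_sub_sub_fderiv_le (convex_closedBall _ _) hκ0.le
      (fun v hv => hF.hasFDerivWithinAt hv) hF.deriv_lipschitz (x := w) (r := r) hw hw hu
      (by simpa using hr0.le) hle
    have h1 := abs_sum_mul_sub_le (hM i) (y := fun j => (F u - F w) j)
      (y' := fun j => ballDeriv F w (u - w) j) (b := κ * r * ‖u - w‖)
      fun j => (PiLp.norm_apply_le (F u - F w - ballDeriv F w (u - w)) j).trans htaylor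
    have h2 : ∑ j, M i j * ballDeriv F w (u - w) j
        = ‖u - w‖ * ∑ j, M i j * ballDeriv F w θ j := by
      have : u - w = ‖u - w‖ • θ := by
        rw [hθ, smul_smul, mul_inv_cancel₀ huw0.ne', one_smul]
      conv_lhs => rw [this, map_smul]
      rw [Finset.mul_sum]
      exact Finset.sum_congr rfl fun j _ => by simp; ring
    rw [h2, abs_mul, abs_of_pos huw0, ← mul_assoc, hgr] at h1
    have h3 : ‖u - w‖ * g ≤ ‖u - w‖ * |∑ j, M i j * ballDeriv F w θ j| := by gcongr
    have h4 : min (g / 2) (b₀ / (8 * D)) * ‖u - w‖ ≤ g / 2 * ‖u - w‖ := by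
      gcongr; exact min_le_left _ _
    linarith
  · have hy : n * b₀ ≤ ‖F u - F w‖ := by
      refine le_trans ?_ (hF.le_dist u hu w hw)
      calc n * b₀ = κ⁻¹ * r := by rw [hb₀, hr]; field_simp
        _ ≤ κ⁻¹ * ‖u - w‖ := by gcongr
    obtain ⟨z, hz, hzh⟩ := hY₀ u hu w hw
    obtain ⟨i, hi⟩ := exists_row_ge_of_net hn hM hp hQ hA hb₀0 hB₀ hy
      ⟨z, hz, fun j => (hzh j).trans hh₀⟩
    refine ⟨i, ?_⟩
    have h1 : ‖u - w‖ ≤ 2 := by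
      have hu1 : ‖u‖ ≤ 1 := by simpa [unitBall] using hu
      have hw1 : ‖w‖ ≤ 1 := by simpa [unitBall] using hw
      linarith [norm_sub_le u w]
    calc min (g / 2) (b₀ / (8 * D)) * ‖u - w‖ ≤ b₀ / (8 * D) * 2 := by
          gcongr; exact min_le_right _ _
      _ = b₀ / (4 * D) := by field_simp; norm_num
      _ ≤ _ := hi

end LowerBound

/-! ### Entropy of the discretizations -/

section Numerics

/-- Source of the squared logarithm: `log n` scales with ratio of order `n`. In this and the next
bounds `n ≥ 2` lets powers of `n` and constants be absorbed into `exp (O((log n)²))`. -/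
theorem pow_log_succ_le_exp {n : ℕ} (hn : 2 ≤ n) :
    ((4 * n : ℕ) : ℝ) ^ (Nat.log 2 n + 1) ≤ Real.exp (9 * Real.log n ^ 2) := by
  have hn0 : (0 : ℝ) < n := by positivity
  have hL : Real.log 2 ≤ Real.log n := Real.log_le_log two_pos (by exact_mod_cast hn)
  have hl2 := Real.log_two_gt_d9
  have hp : Nat.log 2 n * Real.log 2 ≤ Real.log n := by
    rw [← Real.log_pow]
    refine Real.log_le_log (by positivity) ?_
    exact_mod_cast Nat.pow_log_le_self 2 (by omega)
  rw [← Real.log_le_iff_le_exp (by positivity), Real.log_pow]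
  push_cast
  rw [Real.log_mul (by norm_num) hn0.ne', show (4 : ℝ) = 2 ^ 2 by norm_num, Real.log_pow]
  push_cast
  set L := Real.log n
  set q : ℝ := (Nat.log 2 n : ℝ)
  have hq : 0 ≤ q := Nat.cast_nonneg _
  have h1 : q * L ≤ 29 / 20 * L ^ 2 := by
    have h2 : q ≤ 29 / 20 * L := by nlinarith
    nlinarith
  have h2 : L ≤ 29 / 20 * L ^ 2 := by nlinarith
  nlinarith

theorem natCast_le_exp_log_sq {n : ℕ} (hn : 2 ≤ n) :
    (n : ℝ) ≤ Real.exp (3 / 2 * Real.log n ^ 2) := by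
  have hL : Real.log 2 ≤ Real.log n := Real.log_le_log two_pos (by exact_mod_cast hn)
  have hl2 := Real.log_two_gt_d9
  rw [← Real.log_le_iff_le_exp (by positivity)]
  nlinarith

theorem le_exp_mul_log_sq {n : ℕ} (hn : 2 ≤ n) {a : ℝ} (ha : 0 ≤ a) :
    a ≤ Real.exp (21 / 10 * a * Real.log n ^ 2) := by
  have hL : Real.log 2 ≤ Real.log n := Real.log_le_log two_pos (by exact_mod_cast hn)
  have hl2 := Real.log_two_gt_d9
  have h1 : 1 ≤ 21 / 10 * Real.log n ^ 2 := by nlinarith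
  refine le_trans ?_ (Real.add_one_le_exp _)
  nlinarith

theorem mul_two_mul_add_one_le_exp {n : ℕ} (hn : 2 ≤ n) :
    (n : ℝ) * (2 * ((4 * n : ℕ) : ℝ) ^ (Nat.log 2 n + 1) + 1)
      ≤ Real.exp (20 * Real.log n ^ 2) := by
  have h1 := pow_log_succ_le_exp hn
  set D := ((4 * n : ℕ) : ℝ) ^ (Nat.log 2 n + 1)
  have hD : 1 ≤ D := one_le_pow₀ (by exact_mod_cast (by omega : 1 ≤ 4 * n))
  calc (n : ℝ) * (2 * D + 1) ≤ n * (3 * D) := by gcongr; linarith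
    _ ≤ Real.exp (3 / 2 * Real.log n ^ 2) *
        (Real.exp (21 / 10 * 3 * Real.log n ^ 2) * Real.exp (9 * Real.log n ^ 2)) := by
      gcongr
      · exact natCast_le_exp_log_sq hn
      · exact le_exp_mul_log_sq hn (by norm_num)
    _ ≤ _ := by
      rw [← Real.exp_add, ← Real.exp_add, Real.exp_le_exp]
      nlinarith [sq_nonneg (Real.log n)]

theorem net_card_le_exp {n d M : ℕ} (hn : 2 ≤ n) {κ D : ℝ} (hκ : 1 ≤ κ) (hD1 : 1 ≤ D)
    (hD : D ≤ Real.exp (9 * Real.log n ^ 2))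
    (hM : (M : ℝ) ≤ 64 * κ ^ 4 * n ^ 5 * D ^ 2 + 1) :
    ((2 * (M : ℝ) + 1) ^ (2 * d)) ≤ Real.exp (620 * κ ^ 4 * (d * Real.log n ^ 2)) := by
  have hn1 : (1 : ℝ) ≤ n := by exact_mod_cast (by omega : 1 ≤ n)
  have hκ4 : 1 ≤ κ ^ 4 := one_le_pow₀ hκ
  have h1 : 1 ≤ κ ^ 4 * n ^ 5 * D ^ 2 :=
    one_le_mul_of_one_le_of_one_le
      (one_le_mul_of_one_le_of_one_le hκ4 (one_le_pow₀ hn1)) (one_le_pow₀ hD1)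
  have h2 : 2 * (M : ℝ) + 1 ≤ Real.exp (310 * κ ^ 4 * Real.log n ^ 2) := by
    calc 2 * (M : ℝ) + 1 ≤ 131 * κ ^ 4 * n ^ 5 * D ^ 2 := by linarith
      _ ≤ Real.exp (21 / 10 * (131 * κ ^ 4) * Real.log n ^ 2) *
          Real.exp (3 / 2 * Real.log n ^ 2) ^ 5 * Real.exp (9 * Real.log n ^ 2) ^ 2 := by
        gcongr
        · exact le_exp_mul_log_sq hn (by positivity)
        · exact natCast_le_exp_log_sq hn
      _ ≤ _ := by
        rw [← Real.exp_nat_mul, ← Real.exp_nat_mul, ← Real.exp_add, ← Real.exp_add,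
          Real.exp_le_exp]
        push_cast
        have : Real.log n ^ 2 ≤ κ ^ 4 * Real.log n ^ 2 :=
          le_mul_of_one_le_left (sq_nonneg _) hκ4
        nlinarith [sq_nonneg (Real.log n)]
  calc ((2 * (M : ℝ) + 1) ^ (2 * d)) ≤ Real.exp (310 * κ ^ 4 * Real.log n ^ 2) ^ (2 * d) := by
        gcongr
    _ = _ := by
        rw [← Real.exp_nat_mul]; push_cast; congr 1; ring

end Numerics

/-! ### Assembly -/

section Main

variable {Ω : Type*} [MeasurableSpace Ω] {μ : Measure Ω} {d m n s : ℕ}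
  {σ δ : Fin m → Fin n → Ω → ℝ}

/-- Outside of an exceptional set of probability at most `exp (-s / 120)`, the sparse
Johnson-Lindenstrauss transform is bounded below on the differences of points of
`F (unitBall d)`. -/
theorem IsSJLTData.exists_exceptional_set_secant [IsProbabilityMeasure μ]
    (h : IsSJLTData μ m n s σ δ) {κ : ℝ} (hκ : 1 ≤ κ)
    {F : EuclideanSpace ℝ (Fin d) → EuclideanSpace ℝ (Fin n)} (hF : IsBiLipschitzParam κ F)
    (hn : 2 ≤ n) (hd : 0 < d) (hm : 40000 * κ ^ 4 * (d * Real.log n ^ 2) ≤ (m : ℝ))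
    (hs : 40000 * κ ^ 4 * Real.log n ^ 2 ≤ (s : ℝ)) :
    ∃ Z : Set Ω, μ.real Z ≤ Real.exp (-(1 / 120 * s)) ∧ ∀ ω ∉ Z, ∃ c : ℝ, 0 < c ∧
      ∀ u ∈ unitBall d, ∀ w ∈ unitBall d, c * ‖u - w‖ ≤ ‖sjlt s σ δ ω (F u - F w)‖ := by
  have hn0 : 0 < n := by omega
  have hn1 : (1 : ℝ) ≤ n := by exact_mod_cast hn0
  have hκ4 : 1 ≤ κ ^ 4 := one_le_pow₀ hκ
  have hL : Real.log 2 ≤ Real.log n := Real.log_le_log two_pos (by exact_mod_cast hn)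
  have hL2 : 2 / 5 ≤ Real.log n ^ 2 := by nlinarith [Real.log_two_gt_d9]
  have hκL : Real.log n ^ 2 ≤ κ ^ 4 * Real.log n ^ 2 := le_mul_of_one_le_left (sq_nonneg _) hκ4
  have hsL : 40000 * Real.log n ^ 2 ≤ (s : ℝ) := by linarith
  have hs16 : (16000 : ℝ) ≤ s := by linarith
  have hs0 : 0 < s := by
    have : (0 : ℝ) < s := by linarith
    exact_mod_cast this
  have hsm : s ≤ m := h.sparsity_le hn0
  have hsm' : (s : ℝ) ≤ m := by exact_mod_cast hsm
  have hm0 : 0 < m := by omega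
  obtain ⟨p, hpdef⟩ : ∃ p, p = Nat.log 2 n + 1 := ⟨_, rfl⟩
  obtain ⟨Q, hQ⟩ : ∃ Q, Q = 4 * n := ⟨_, rfl⟩
  have hp : n < 2 ^ p := hpdef ▸ Nat.lt_pow_succ_log_self one_lt_two n
  have hDexp := pow_log_succ_le_exp hn
  have hNexp := mul_two_mul_add_one_le_exp hn
  rw [← hQ, ← hpdef] at hDexp hNexp
  have hQ1 : (1 : ℝ) ≤ Q := by rw [hQ]; push_cast; linarith
  have hD1 : 1 ≤ (Q : ℝ) ^ p := one_le_pow₀ hQ1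
  obtain ⟨M, hMdef⟩ : ∃ M, M = ⌈64 * κ ^ 4 * n ^ 5 * ((Q : ℝ) ^ p) ^ 2⌉₊ := ⟨_, rfl⟩
  have hMge : 64 * κ ^ 4 * n ^ 5 * ((Q : ℝ) ^ p) ^ 2 ≤ M := hMdef ▸ Nat.le_ceil _
  have hMle : (M : ℝ) ≤ 64 * κ ^ 4 * n ^ 5 * ((Q : ℝ) ^ p) ^ 2 + 1 :=
    hMdef ▸ (Nat.ceil_lt_add_one (by positivity)).le
  have hM0' : (0 : ℝ) < M := lt_of_lt_of_le (by positivity) hMge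
  have hM0 : 0 < M := by exact_mod_cast hM0'
  have hκ0 : 0 < κ := by linarith
  have hdn : (d : ℝ) ≤ n := by exact_mod_cast hF.dim_le hκ0
  obtain ⟨Y₀, hY₀c, hY₀⟩ := hF.exists_secant_net hκ0.le hM0
  obtain ⟨Y₁, hY₁c, hY₁⟩ := hF.exists_tangent_net hκ0.le hM0
  have hcard := net_card_le_exp (d := d) hn hκ hD1 hDexp hMle
  have hdiv : s * (m / s) ≤ m := Nat.mul_div_le m s
  -- As `s ≤ m`, the floor loses at most half, so spread vectors have small ball probability at most
  -- `exp (-m / 30)`; the constant `40000` keeps the nets below `exp (m / 60)`.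
  have hdiv2 : (m : ℝ) / 2 ≤ s * (m / s : ℕ) := by
    have h1 : m < s * (m / s + 1) := Nat.lt_mul_div_succ m hs0
    have h2 : 1 ≤ m / s := (Nat.one_le_div_iff hs0).2 hsm
    have h3 : s * 1 ≤ s * (m / s) := Nat.mul_le_mul_left s h2
    have h4 : m ≤ 2 * (s * (m / s)) := by rw [mul_add] at h1; omega
    have h5 : (m : ℝ) ≤ 2 * (s * (m / s : ℕ)) := by exact_mod_cast h4
    linarith
  have hnet : ∀ Y : Finset (Fin n → ℝ), Y.card ≤ (2 * M + 1) ^ (2 * d) →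
      Y.card * Real.exp (-(s * (m / s : ℕ) / 15)) ≤ Real.exp (-(s / 60)) := by
    intro Y hY
    have h1 : (Y.card : ℝ) ≤ Real.exp (m / 60) := by
      calc (Y.card : ℝ) ≤ (2 * (M : ℝ) + 1) ^ (2 * d) := by exact_mod_cast hY
        _ ≤ _ := hcard
        _ ≤ _ := by
          rw [Real.exp_le_exp]
          have : 0 ≤ κ ^ 4 * (d * Real.log n ^ 2) := by positivity
          linarith
    calc Y.card * Real.exp (-(s * (m / s : ℕ) / 15))
        ≤ Real.exp (m / 60) * Real.exp (-(s * (m / s : ℕ) / 15)) := by gcongr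
      _ ≤ _ := by
        rw [← Real.exp_add, Real.exp_le_exp]
        linarith
  obtain ⟨b₀, hb₀⟩ : ∃ b, b = 1 / (8 * κ ^ 3 * n ^ 3 * (Q : ℝ) ^ p) := ⟨_, rfl⟩
  obtain ⟨b₁, hb₁⟩ : ∃ b, b = 1 / (κ * n) := ⟨_, rfl⟩
  obtain ⟨ZA, hZA, hA⟩ := h.exists_sparse_exceptional_set hm0 ((Q : ℝ) - 1) (N := Q ^ p) (by
    push_cast
    refine hNexp.trans ?_
    rw [Real.exp_le_exp]
    linarith)
  obtain ⟨Z₀, hZ₀, hB₀⟩ := h.exists_exceptional_set hm0 hdiv (b₀ / (2 * (Q : ℝ) ^ p)) Y₀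
  obtain ⟨Z₁, hZ₁, hB₁⟩ := h.exists_exceptional_set hm0 hdiv (b₁ / (2 * (Q : ℝ) ^ p)) Y₁
  refine ⟨ZA ∪ Z₀ ∪ Z₁, ?_, fun ω hω => ?_⟩
  · have hZA' : (n : ℝ) * Real.exp (-(s / 30)) ≤ Real.exp (-(s / 60)) := by
      calc (n : ℝ) * Real.exp (-(s / 30))
          ≤ Real.exp (3 / 2 * Real.log n ^ 2) * Real.exp (-(s / 30)) := by
            gcongr
            exact natCast_le_exp_log_sq hn
        _ ≤ _ := by
            rw [← Real.exp_add, Real.exp_le_exp]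
            linarith
    -- Half of the rate `1/60` pays for the union of three exceptional sets.
    have h3 : (3 : ℝ) ≤ Real.exp (s / 120) := by
      linarith [Real.add_one_le_exp ((s : ℝ) / 120)]
    calc μ.real (ZA ∪ Z₀ ∪ Z₁) ≤ μ.real ZA + μ.real Z₀ + μ.real Z₁ :=
          (measureReal_union_le _ _).trans (by gcongr; exact measureReal_union_le _ _)
      _ ≤ 3 * Real.exp (-(s / 60)) := by
          linarith [hnet Y₀ hY₀c, hnet Y₁ hY₁c]
      _ ≤ Real.exp (s / 120) * Real.exp (-(s / 60)) := by gcongr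
      _ = Real.exp (-(1 / 120 * s)) := by
          rw [← Real.exp_add]
          congr 1
          ring
  · simp only [mem_union, not_or] at hω
    have hmesh : 2 * κ * (d / M) ≤ 1 / (32 * κ ^ 3 * n ^ 4 * ((Q : ℝ) ^ p) ^ 2) := by
      rw [← mul_div_assoc, div_le_div_iff₀ hM0' (by positivity), one_mul]
      calc 2 * κ * d * (32 * κ ^ 3 * n ^ 4 * ((Q : ℝ) ^ p) ^ 2)
          ≤ 2 * κ * n * (32 * κ ^ 3 * n ^ 4 * ((Q : ℝ) ^ p) ^ 2) := by gcongr
        _ = 64 * κ ^ 4 * n ^ 5 * ((Q : ℝ) ^ p) ^ 2 := by ring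
        _ ≤ M := hMge
    obtain ⟨c, hc0, hc⟩ := hF.exists_row_ge_secant hκ hn0 (fun i j => h.abs_entry_le ω i j) hp hQ
      (hA ω hω.1.1) hb₁ hb₀ hmesh (hB₀ ω hω.1.2) (hB₁ ω hω.2) hY₀ hY₁
    refine ⟨c / √s, by positivity, fun u hu w hw => ?_⟩
    rcases eq_or_ne u w with rfl | huw
    · simp
    obtain ⟨i, hi⟩ := hc u hu w hw huw
    refine le_trans ?_ (abs_sum_div_sqrt_le_norm_sjlt hs0 ω (F u - F w) i)
    rw [div_mul_eq_mul_div]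
    gcongr

/-- In dimension at most one the transform is bounded below. -/
theorem IsSJLTData.norm_sjlt_ge_of_le_one (h : IsSJLTData μ m n s σ δ) (hn : n ≤ 1) (hs : 0 < s)
    (ω : Ω) (y : EuclideanSpace ℝ (Fin n)) : ‖y‖ / √s ≤ ‖sjlt s σ δ ω y‖ := by
  interval_cases n
  · rw [Subsingleton.elim y 0]; simp
  · obtain ⟨i, hi⟩ : ∃ i, δ i 0 ω = 1 := by
      by_contra! hne
      have h1 := h.sel_card 0 ω
      rw [Finset.sum_eq_zero fun i _ => (h.sel_values i 0 ω).resolve_right (hne i)] at h1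
      have : s = 0 := by exact_mod_cast h1.symm
      omega
    refine le_trans (le_of_eq ?_) (abs_sum_div_sqrt_le_norm_sjlt hs ω y i)
    rcases h.sign_values i 0 ω with h2 | h2 <;>
      simp [hi, h2, EuclideanSpace.norm_eq, Real.sqrt_sq_eq_abs]

end Main

theorem mainTheorem9 :
    ∃ c : ℝ, 0 < c ∧ ∀ κ : ℝ, 1 ≤ κ → ∃ C : ℝ, 0 < C ∧
      ∀ (d n m s : ℕ) (F : EuclideanSpace ℝ (Fin d) → EuclideanSpace ℝ (Fin n)),
        IsBiLipschitzParam κ F →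
        C * (d * Real.log n ^ 2) ≤ (m : ℝ) →
        C * Real.log n ^ 2 ≤ (s : ℝ) →
        ∀ (Ω : Type*) [MeasurableSpace Ω] (μ : Measure Ω) [IsProbabilityMeasure μ]
          (σ δ : Fin m → Fin n → Ω → ℝ), IsSJLTData μ m n s σ δ →
          ∃ A : Set Ω, MeasurableSet A ∧
            1 - ENNReal.ofReal (Real.exp (-(c * s))) ≤ μ A ∧
            ∀ ω ∈ A, ∀ ε : ℝ, 0 < ε → ε < 1 →
              (∀ v ∈ unitTangentVectors F,
                1 - ε ≤ ‖sjlt s σ δ ω v‖ ∧ ‖sjlt s σ δ ω v‖ ≤ 1 + ε) →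
              ∀ x ∈ F '' unitBall d, ∀ y ∈ F '' unitBall d,
                ENNReal.ofReal (1 - ε) * geodesicDist (F '' unitBall d) x y ≤
                    geodesicDist (sjlt s σ δ ω '' (F '' unitBall d))
                      (sjlt s σ δ ω x) (sjlt s σ δ ω y) ∧
                geodesicDist (sjlt s σ δ ω '' (F '' unitBall d))
                      (sjlt s σ δ ω x) (sjlt s σ δ ω y) ≤
                    ENNReal.ofReal (1 + ε) * geodesicDist (F '' unitBall d) x y := by
  refine ⟨1 / 120, by norm_num, fun κ hκ => ⟨40000 * κ ^ 4, by positivity, ?_⟩⟩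
  intro d n m s F hF hm hs Ω _ μ _ σ δ h
  have hκ0 : 0 < κ := by linarith
  suffices hZ : ∃ Z : Set Ω, μ.real Z ≤ Real.exp (-(1 / 120 * s)) ∧ ∀ ω ∉ Z, ∃ c : ℝ, 0 < c ∧
      ∀ u ∈ unitBall d, ∀ w ∈ unitBall d, c * ‖u - w‖ ≤ ‖sjlt s σ δ ω (F u - F w)‖ by
    obtain ⟨Z, hZ, hgood⟩ := hZ
    -- The exceptional set is not claimed to be measurable, so its measurable hull is removed.
    refine ⟨(toMeasurable μ Z)ᶜ, (measurableSet_toMeasurable μ Z).compl, ?_, fun ω hω => ?_⟩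
    · rw [prob_compl_eq_one_sub (measurableSet_toMeasurable μ Z), measure_toMeasurable]
      refine tsub_le_tsub_left ?_ _
      rw [← ENNReal.ofReal_toReal (measure_ne_top μ Z)]
      exact ENNReal.ofReal_le_ofReal hZ
    · intro ε hε hε1 htan x hx y hy
      obtain ⟨c, hc0, hc⟩ := hgood ω fun hmem => hω (subset_toMeasurable μ Z hmem)
      exact geodesicDist_bounds hκ0 hF _ hc0 hc hε hε1 htan hx hy
  -- Degenerate cases: for `s = 0` the probability bound is void, for `d = 0` the ball is a point,
  -- and for `n ≤ 1` the logarithm vanishes, so the hypotheses on `m` and `s` say nothing, but one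
  -- nonzero entry per column suffices.
  rcases Nat.eq_zero_or_pos s with rfl | hs0
  · exact ⟨univ, by simp, fun ω hω => absurd (mem_univ ω) hω⟩
  rcases Nat.eq_zero_or_pos d with rfl | hd
  · refine ⟨∅, by simp [Real.exp_nonneg], fun ω _ => ⟨1, one_pos, fun u _ w _ => ?_⟩⟩
    rw [Subsingleton.elim u w]; simp
  rcases Nat.lt_or_ge n 2 with hn | hn
  · refine ⟨∅, by simp [Real.exp_nonneg], fun ω _ => ⟨κ⁻¹ / √s, by positivity, fun u hu w hw => ?_⟩⟩
    refine le_trans ?_ (h.norm_sjlt_ge_of_le_one (by omega) hs0 ω _)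
    rw [div_mul_eq_mul_div]
    gcongr
    exact hF.le_dist u hu w hw
  · exact h.exists_exceptional_set_secant hκ hF hn hd hm hs
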